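/- **Conventions.** For a C*-algebra $A$ (unital or not), $\mathfrak{sa}(A)$ is its self-adjoint part and $\mathscr S(A)$ its state space. A *Lipschitz triple* $(A,L,M)$ consists of a C*-algebra $A$, a seminorm $L$ with dense domain in $\mathfrak{sa}(A)$ (put $L=\infty$ elsewhere) such that $L(a)=0$ exactly when $a$ is a real multiple of the unit of the smallest unital C*-algebra containing $A$ (so $a\in\mathbb R1$ if $A$ is unital, $a=0$ otherwise), and an Abelian C*-subalgebra $M\subseteq A$ containing an approximate unit of $A$. Let $M^\sigma$ be the Gel'fand spectrum of $M$; for compact $K\subseteq M^\sigma$ let $1_K$ be the indicator projection of $K$ in $M^{**}\subseteq A^{**}$. Put - $\mathrm{mk}_L(\varphi,\psi)=\sup\{|\varphi(a)-\psi(a)| : a\in\mathfrak{sa}(A),\,L(a)\le 1\}$ on $\mathscr S(A)$, and $\mathrm{mk}^\sigma_L$ for the same formula with $a\in\mathfrak{sa}(M)$ on $M^\sigma$; - $\mathscr S[A|K]=\{\varphi\in\mathscr S(A):\varphi(1_K)=1\}$, $\mathrm{Loc}[A|K]=\{a\in\mathfrak{sa}(A): 1_Ka1_K=a,\ L(a)<\infty\}$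 and $\mathrm{Loc}[A|\star]=\bigcup_K\mathrm{Loc}[A|K]$. A set $S\subseteq\mathscr S(A)$ is *tame* if $\lim_{K}\sup\{|\varphi(a-1_Ka1_K)|:\varphi\in S,\,a\in\mathfrak{sa}(A),\,L(a)\le1\}=0$, the limit being taken over the compact subsets of $M^\sigma$ directed by inclusion. The triple is a *quantum locally compact metric space* if $\mathrm{mk}_L$ induces the weak* topology on every tame set. It is a *proper quantum metric space* if moreover $A$ is separable; $L$ is norm lower semi-continuous; $L(\frac{ab+ba}2)$ and $L(\frac{ab-ba}{2i})$ are at most $\|a\|L(b)+L(a)\|b\|$ for all $a,b\in\mathfrak{sa}(A)$; $\mathrm{Loc}[A|\star]$ is dense in $\{L<\infty\}$; $\mathrm{Loc}[A|\star]\cap M$ is dense in $\mathfrak{sa}(M)$; and $(M^\sigma,\mathrm{mk}^\sigma_L)$ is a metric space with compact closed balls. A *pointed* proper quantum metric space $(A,L,M,\mu)$ has in addition a base point $\mu\in M^\sigma$. Write $\mathrm{Loc}[A|\mu,r]$ and $\mathscr S[A|\mu,r]$ when $K$ is the closed $\mathrm{mk}^\sigma_L$-ball of radius $r$ about $\mu$.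 A *topographic morphism* $(A,L_A,M_A)\to(B,L_B,M_B)$ is a surjective $*$-homomorphism sending $M_A$ into $M_B$ and some approximate unit of $A$ contained in $M_A$ to an approximate unit of $B$. A *passage* $\tau=(D,L_D,M_D,\pi,\mathbb A,\rho,\mathbb B)$ between pointed proper quantum metric spaces $\mathbb A=(A,L_A,M_A,\mu_A)$ and $\mathbb B=(B,L_B,M_B,\mu_B)$ is a quantum locally compact metric space $(D,L_D,M_D)$ with $L_D$ norm lower semi-continuous and topographic morphisms $\pi:D\to A$, $\rho:D\to B$; its inverse is $\tau^{-1}=(D,L_D,M_D,\rho,\mathbb B,\pi,\mathbb A)$. For $\varepsilon>0$, $r>0$ and compact $K\subseteq M_D^\sigma$, the pair $(\varepsilon,K)$ is *$r$-left admissible* if: 1. $\varphi\circ\pi\in\mathscr S[D|K]$ for all $\varphi\in\mathscr S[A|\mu_A,r]$; 2. each $\varphi\in\mathscr S[D|K]$ is within $\mathrm{mk}_{L_D}$-distance $\varepsilon$ of $\psi\circ\pi$ for some $\psi\in\mathscr S[A|\mu_A,r+4\varepsilon]$; 3. for each $a\in\mathrm{Loc}[A|\mu_A,r]$ there is $d\in\mathrm{Loc}[D|K]$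 with $\pi(d)=a$, $L_D(d)\le L_A(a)$ and $\rho(d)\in\mathrm{Loc}[B|\mu_B,r+4\varepsilon]$; 4. if in addition $a\in M_A$, then $d$ can be chosen with $\rho(d)\in M_B$; 5. $L_B(\rho(d))\le L_D(d)$ for all $d\in\mathrm{Loc}[D|K]$. It is *$r$-admissible* if it is $r$-left admissible for $\tau$ and for $\tau^{-1}$, $\mathrm{mk}^\sigma_{L_D}(\mu_A\circ\pi,\mu_B\circ\rho)\le\varepsilon$, and the two Leibniz inequalities above hold for $L_D$ on $\mathrm{Loc}[D|K]$. A number $\varepsilon>0$ is *$r$-admissible* if there is an increasing family $(K_t)_{0<t\le r}$ of compact sets with $(\varepsilon,K_t)$ $t$-admissible for every $t\in(0,r]$; the *$r$-extent* $\chi(\tau|r)$ is the infimum of the $r$-admissible numbers, and $\tau$ is an *$r$-tunnel* if there is one. An *isometric isomorphism* $h:\mathbb A\to\mathbb B$ is a topographic morphism that is a $*$-isomorphism with $h(\mathrm{Loc}[A|\star])=\mathrm{Loc}[B|\star]$, $h(M_A)=M_B$, $L_B\circ h=L_A$ on $\mathrm{Loc}[A|\star]$ and $\mu_B\circ h=\mu_A$.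 A class $\mathcal T$ of passages is *weakly appropriate* for a class $\mathcal C$ of pointed proper quantum metric spaces if: every $\tau\in\mathcal T$ is an $r$-tunnel between elements of $\mathcal C$ for some $r>0$; $\mathcal T$ is closed under inverses; if $\tau_1,\tau_2\in\mathcal T$ are $r$-tunnels from $\mathbb A$ to $\mathbb B$ and from $\mathbb B$ to $\mathbb E$, $\varepsilon_i>\chi(\tau_i|r)$, $0<t\le r-4\max\{\varepsilon_1,\varepsilon_2\}$ and $\alpha>0$, then some $t$-tunnel in $\mathcal T$ from $\mathbb A$ to $\mathbb E$ has $t$-extent at most $\varepsilon_1+\varepsilon_2+\alpha$; and for each isometric isomorphism $h:\mathbb A\to\mathbb B$ in $\mathcal C$ the passages $(A,L_A,M_A,\mathrm{id},\mathbb A,h,\mathbb B)$ and $(B,L_B,M_B,\mathrm{id},\mathbb B,h^{-1},\mathbb A)$ lie in $\mathcal T$. Let $\Lambda_{r,\mathcal T}(\mathbb A,\mathbb B)$ be the infimum (possibly $\infty$) of the $r$-extents of the $r$-tunnels in $\mathcal T$ from $\mathbb A$ to $\mathbb B$. The *topographic propinquity* is $$\Lambda_{\mathcal T}(\mathbb A,\mathbb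 B)=\min\Big\{\inf\{\varepsilon>0:\Lambda_{1/\varepsilon,\mathcal T}(\mathbb A,\mathbb B)<\varepsilon\},\tfrac{\sqrt2}4\Big\}.$$ The *hypertopology* on $\mathcal C$ is given by the closure operator sending a subclass to the class of elements of $\mathcal C$ that are limits, for $\Lambda_{\mathcal T}$, of sequences in the subclass. Pointed proper metric spaces $(X_n,d_n,x_n)$ *converge to $(Y,d_Y,y)$ in the Gromov-Hausdorff sense* if for each $r>0$ the infimum of all $\varepsilon>0$ for which there are isometric embeddings of $X_n$ and $Y$ into a common metric space with $d(x_n,y)\le\varepsilon$, with every point of the closed ball of $X_n$ of radius $r$ about $x_n$ within $\varepsilon$ of some point of $Y$, and with every point of the closed ball of $Y$ of radius $r$ about $y$ within $\varepsilon$ of some point of $X_n$, tends to $0$ as $n\to\infty$. **Theorem.** Let $L_X$ be the Lipschitz seminorm on the real-valued functions in $C_0(X)$. For every pointed proper metric space $(X,d,x)$, $(C_0(X),L_X,C_0(X),x)$ is a pointed proper quantum metric space. Let $\mathcal C$ be a class of pointed proper quantum metric spaces containing all of these, and let $\mathcal T$ be a class of passages, weakly appropriate for $\mathcal C$, that contains,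 for all pointed proper metric spaces $X,Y$, every proper metric space $Z$ and all isometric embeddings $\iota_X:X\to Z$, $\iota_Y:Y\to Z$, the passage $(C_0(Z),L_Z,C_0(Z),\iota_X^*,X,\iota_Y^*,Y)$ whenever it is an $r$-tunnel for some $r>0$. Let pointed proper metric spaces $(X_n,d_n,x_n)$ converge to a pointed proper metric space $(Y,d_Y,y)$ in the Gromov-Hausdorff sense. If $Y$ is not compact, or if the diameters of the $X_n$ are bounded by a common constant for all large $n$, then $$\lim_{n\to\infty}\Lambda_{\mathcal T}\big((C_0(X_n),L_{X_n},C_0(X_n),x_n),\,(C_0(Y),L_Y,C_0(Y),y)\big)=0 .$$ In particular, on non-compact classical spaces the hypertopology is weaker than the Gromov-Hausdorff topology: if a non-compact $Y$ is the Gromov-Hausdorff limit of a sequence in a class $S$ of pointed proper metric spaces, then $(C_0(Y),L_Y,C_0(Y),y)$ is in the hypertopology closure of the class of all $(C_0(X),L_X,C_0(X),x)$ with $(X,d,x)\in S$. -/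

import Mathlib

open Filter Topology Set
open scoped ENNReal ComplexOrder CStarAlgebra ZeroAtInfty

universe u

namespace TopoProp

noncomputable section

/-! ### Triples `(A, L, M)`, states, indicator projections -/

/-- The raw data `(A, L, M)`: a (possibly non-unital) C*-algebra, an extended-valued function `L`
(the value `∞` meaning "outside of the domain"), and a star subalgebra `M`. The axioms are stated
in the predicates below. -/
structure LipTriple where
  carrier : Type u
  [alg : NonUnitalCStarAlgebra carrier]
  L : carrier → ℝ≥0∞
  M : NonUnitalStarSubalgebra ℂ carrier

attribute [instance] LipTriple.alg

/-- The state space of a C*-algebra (positive functionals of norm one), with the weak* topology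
inherited from `WeakDual`. -/
def stateSpace (A : Type u) [NonUnitalCStarAlgebra A] : Set (WeakDual ℂ A) :=
  {φ | (∀ a : A, 0 ≤ φ (star a * a)) ∧ ‖WeakDual.toStrongDual φ‖ = 1}

/-- The dual map `φ ↦ φ ∘ π` of a star homomorphism. -/
def pullback {A B : Type u} [NonUnitalCStarAlgebra A] [NonUnitalCStarAlgebra B]
    (π : A →⋆ₙₐ[ℂ] B) (φ : WeakDual ℂ B) : WeakDual ℂ A :=
  StrongDual.toWeakDual ((WeakDual.toStrongDual φ).comp ⟨(π : A →ₗ[ℂ] B), map_continuous π⟩)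

/-- `a` is a real multiple of the unit of the smallest unital C*-algebra containing `A`:
if `A` has a unit, this says `a ∈ ℝ 1`; if `A` has no unit, it says `a = 0`. -/
def IsRealScalar {A : Type u} [NonUnitalCStarAlgebra A] (a : A) : Prop :=
  ∃ c : ℝ, ∀ b : A, a * b = (c : ℂ) • b ∧ b * a = (c : ℂ) • b

/-- The Jordan product `(ab + ba) / 2`. -/
def jordan {A : Type u} [NonUnitalCStarAlgebra A] (a b : A) : A :=
  (2⁻¹ : ℂ) • (a * b + b * a)

/-- The Lie product `(ab - ba) / (2i)`. -/
def lie {A : Type u} [NonUnitalCStarAlgebra A] (a b : A) : A :=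
  (2 * Complex.I)⁻¹ • (a * b - b * a)

namespace LipTriple

variable (A : LipTriple.{u})

/-- The Gel'fand spectrum of the topography, with its weak* topology. -/
abbrev Spec : Type u := WeakDual.characterSpace ℂ A.M

/-- Lipschitz pair: `L` is a seminorm with domain `{L < ∞}` a dense subspace of the self-adjoint
part, and its kernel consists of the real multiples of the unit. -/
structure IsLipschitzPair : Prop where
  isSelfAdjoint : ∀ a, A.L a < ∞ → IsSelfAdjoint a
  add_le : ∀ a b, A.L (a + b) ≤ A.L a + A.L b
  smul : ∀ (c : ℝ) a, A.L ((c : ℂ) • a) = ENNReal.ofReal |c| * A.L a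
  dense : ∀ a, IsSelfAdjoint a → a ∈ closure {b | A.L b < ∞}
  eq_zero_iff : ∀ a, A.L a = 0 ↔ IsSelfAdjoint a ∧ IsRealScalar a

/-- Topographic quantum space: `M` is an Abelian C*-subalgebra containing an approximate unit of
the whole algebra. -/
structure IsTopographic : Prop where
  isClosed : IsClosed (A.M : Set A.carrier)
  comm : ∀ a ∈ A.M, ∀ b ∈ A.M, a * b = b * a
  approxUnit : ∃ l : Filter A.carrier, l.IsApproximateUnit ∧ (A.M : Set A.carrier) ∈ l

/-- The elements `m` of the topography whose Gel'fand transform takes its values in `[0, 1]` and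
equals `1` on `K`. -/
def cutoffs (K : Set A.Spec) : Set A.M :=
  {m | ∀ χ : A.Spec, (∃ s ∈ Icc (0 : ℝ) 1, χ m = (s : ℂ)) ∧ (χ ∈ K → χ m = 1)}

/-- The filter of the decreasing net `cutoffs K`. For compact `K`, this net decreases in the bidual
of `M` (hence strongly) to the indicator projection `1_K`. -/
def indicatorFilter (K : Set A.Spec) : Filter A.M :=
  ⨅ m₀ ∈ A.cutoffs K, 𝓟 {m | m ∈ A.cutoffs K ∧ ∀ χ : A.Spec, (χ m).re ≤ (χ m₀).re}

/-- `φ(1_K)`, for the normal extension of a state `φ` to the bidual: since the net of cutoffs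
decreases to `1_K`, this is the limit of `φ(m)` along it (a bounded monotone net). -/
def evalIndicator (φ : WeakDual ℂ A.carrier) (K : Set A.Spec) : ℂ :=
  limUnder (A.indicatorFilter K) fun m => φ (m : A.carrier)

/-- `φ(1_K a 1_K)`, for the normal extension of a state `φ` to the bidual: the net of cutoffs is
bounded and converges strongly to `1_K`, so `m a m` converges weakly to `1_K a 1_K`. -/
def evalCorner (φ : WeakDual ℂ A.carrier) (K : Set A.Spec) (a : A.carrier) : ℂ :=
  limUnder (A.indicatorFilter K) fun m => φ ((m : A.carrier) * a * (m : A.carrier))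

/-- `𝒮[A|K]`: the states `φ` with `φ(1_K) = 1`. -/
def statesOn (K : Set A.Spec) : Set (WeakDual ℂ A.carrier) :=
  {φ | φ ∈ stateSpace A.carrier ∧ A.evalIndicator φ K = 1}

/-- The self-adjoint elements `a` of `A` with `a = 1_K a 1_K`. The equality holds in the bidual of
`A`, whose elements are separated by the states of `A`. -/
def localSa (K : Set A.Spec) : Set A.carrier :=
  {a | IsSelfAdjoint a ∧ ∀ φ ∈ stateSpace A.carrier, A.evalCorner φ K a = φ a}

/-- `Loc[A|K]`: locally supported elements with finite Lip-norm. -/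
def loc (K : Set A.Spec) : Set A.carrier := {a | a ∈ A.localSa K ∧ A.L a < ∞}

/-- `Loc[A|⋆]`, the union of the sets `Loc[A|K]` over compact `K`. -/
def locStar : Set A.carrier := {a | ∃ K : Set A.Spec, IsCompact K ∧ a ∈ A.loc K}

/-- The Monge-Kantorovich extended metric. -/
def mkDist (φ ψ : WeakDual ℂ A.carrier) : ℝ≥0∞ :=
  ⨆ (a : A.carrier) (_ : IsSelfAdjoint a ∧ A.L a ≤ 1), ‖φ a - ψ a‖ₑ

/-- The Monge-Kantorovich extended metric of the topography `(M, L)`, for functions on `M`; it is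
only applied to characters of `M`. -/
def mkTop (f g : A.M → ℂ) : ℝ≥0∞ :=
  ⨆ (m : A.M) (_ : IsSelfAdjoint (m : A.carrier) ∧ A.L m ≤ 1), ‖f m - g m‖ₑ

/-- Closed ball of the spectrum of the topography for its Monge-Kantorovich metric. -/
def specBall (μ : A.Spec) (r : ℝ) : Set A.Spec :=
  {χ | A.mkTop χ μ ≤ ENNReal.ofReal r}

/-- Tame sets of states. The limit is taken over the directed set of compact subsets. -/
def IsTame (S : Set (WeakDual ℂ A.carrier)) : Prop :=
  Tendsto (fun K : TopologicalSpace.Compacts A.Spec =>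
      ⨆ (φ ∈ S) (a : A.carrier) (_ : IsSelfAdjoint a ∧ A.L a ≤ 1),
        ‖φ a - A.evalCorner φ (K : Set A.Spec) a‖ₑ)
    atTop (𝓝 0)

/-- Quantum locally compact metric space: a Lipschitz triple such that, on every tame set of
states, the Monge-Kantorovich metric induces the weak* topology. -/
structure IsQuantumLocallyCompact : Prop where
  lipschitzPair : A.IsLipschitzPair
  topographic : A.IsTopographic
  metrizes : ∀ S ⊆ stateSpace A.carrier, A.IsTame S → ∀ φ ∈ S,
    𝓝[S] φ = ⨅ (ε : ℝ) (_ : 0 < ε), 𝓟 {ψ | ψ ∈ S ∧ A.mkDist φ ψ < ENNReal.ofReal ε}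

/-- The Leibniz inequalities for the elements of a set. -/
def LeibnizOn (S : Set A.carrier) : Prop :=
  ∀ a ∈ S, ∀ b ∈ S,
    A.L (jordan a b) ≤ ‖a‖ₑ * A.L b + A.L a * ‖b‖ₑ ∧
    A.L (lie a b) ≤ ‖a‖ₑ * A.L b + A.L a * ‖b‖ₑ

/-- Norm lower semi-continuity of `L` on the self-adjoint part. -/
def IsLsc : Prop := LowerSemicontinuousOn A.L {a | IsSelfAdjoint a}

/-- Proper quantum metric spaces. -/
structure IsProperQuantum : Prop where
  quantumLocallyCompact : A.IsQuantumLocallyCompact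
  separable : TopologicalSpace.SeparableSpace A.carrier
  leibniz : A.LeibnizOn {a | IsSelfAdjoint a}
  lsc : A.IsLsc
  locStar_dense : {a | A.L a < ∞} ⊆ closure A.locStar
  locStar_inter_dense : {m | m ∈ A.M ∧ IsSelfAdjoint m} ⊆ closure (A.locStar ∩ A.M)
  /-- The spectrum of the topography, with its Monge-Kantorovich metric, is a metric space whose
  closed balls are compact. -/
  spec_proper : ∃ d : MetricSpace A.Spec,
    (∀ χ ξ : A.Spec, ENNReal.ofReal (d.dist χ ξ) = A.mkTop χ ξ) ∧
    @ProperSpace A.Spec d.toPseudoMetricSpace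

end LipTriple

/-- Topographic morphisms: *-epimorphisms which map the topography into the topography and some
approximate unit in the topography to an approximate unit. -/
structure IsTopographicMorphism (A B : LipTriple.{u}) (π : A.carrier →⋆ₙₐ[ℂ] B.carrier) :
    Prop where
  surjective : Function.Surjective π
  map_mem : ∀ m ∈ A.M, π m ∈ B.M
  map_approxUnit : ∃ l : Filter A.carrier, l.IsApproximateUnit ∧ (A.M : Set A.carrier) ∈ l ∧
    (l.map π).IsApproximateUnit

/-! ### Pointed proper quantum metric spaces -/

/-- The raw data `(A, L, M, μ)`, where `μ` is a character of `M`. -/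
structure PointedTriple extends LipTriple.{u} where
  pt : toLipTriple.Spec

namespace PointedTriple

variable (A : PointedTriple.{u})

/-- Pointed proper quantum metric spaces. -/
def IsPPQMS : Prop := A.toLipTriple.IsProperQuantum

/-- `Loc[A|μ,r]`. -/
def locBall (r : ℝ) : Set A.carrier := A.loc (A.specBall A.pt r)

/-- `𝒮[A|μ,r]`. -/
def statesBall (r : ℝ) : Set (WeakDual ℂ A.carrier) := A.statesOn (A.specBall A.pt r)

end PointedTriple

/-- Isometric isomorphisms of pointed proper quantum metric spaces. -/
structure IsIsometricIso (A B : PointedTriple.{u}) (h : A.carrier ≃⋆ₐ[ℂ] B.carrier) : Prop where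
  topographic : IsTopographicMorphism A.toLipTriple B.toLipTriple
    (h : A.carrier →⋆ₙₐ[ℂ] B.carrier)
  image_locStar : h '' A.locStar = B.locStar
  image_top : h '' (A.M : Set A.carrier) = (B.M : Set B.carrier)
  lip_eq : ∀ a ∈ A.locStar, B.L (h a) = A.L a
  pt_eq : ∀ (m : A.carrier) (hm : m ∈ A.M),
    B.pt ⟨h m, topographic.map_mem m hm⟩ = A.pt ⟨m, hm⟩

/-! ### Passages, admissibility, tunnels -/

/-- The raw data of a passage from `dom` to `cod`. -/
structure Passage where
  dom : PointedTriple.{u}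
  cod : PointedTriple.{u}
  D : LipTriple.{u}
  π : D.carrier →⋆ₙₐ[ℂ] dom.carrier
  ρ : D.carrier →⋆ₙₐ[ℂ] cod.carrier
  π_mem : ∀ m ∈ D.M, π m ∈ dom.M
  ρ_mem : ∀ m ∈ D.M, ρ m ∈ cod.M

namespace Passage

variable (τ : Passage.{u})

/-- Passages between pointed proper quantum metric spaces. -/
structure IsPassage : Prop where
  dom_ppqms : τ.dom.IsPPQMS
  cod_ppqms : τ.cod.IsPPQMS
  quantumLocallyCompact : τ.D.IsQuantumLocallyCompact
  lsc : τ.D.IsLsc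
  topographic_left : IsTopographicMorphism τ.D τ.dom.toLipTriple τ.π
  topographic_right : IsTopographicMorphism τ.D τ.cod.toLipTriple τ.ρ

/-- The inverse passage. -/
def inv : Passage.{u} := ⟨τ.cod, τ.dom, τ.D, τ.ρ, τ.π, τ.ρ_mem, τ.π_mem⟩

/-- Lift sets. -/
def liftSet (a : τ.dom.carrier) (l : ℝ≥0∞) (r ε : ℝ) (K : Set τ.D.Spec) : Set τ.D.carrier :=
  {d | d ∈ τ.D.loc K ∧ τ.π d = a ∧ τ.ρ d ∈ τ.cod.locBall (r + 4 * ε) ∧ τ.D.L d ≤ l}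

/-- Target sets. -/
def targetSet (a : τ.dom.carrier) (l : ℝ≥0∞) (r ε : ℝ) (K : Set τ.D.Spec) :
    Set τ.cod.carrier :=
  τ.ρ '' τ.liftSet a l r ε K

/-- `(ε, K)` is `r`-left admissible. -/
structure IsLeftAdmissible (r ε : ℝ) (K : Set τ.D.Spec) : Prop where
  states_subset : ∀ φ ∈ τ.dom.statesBall r, pullback τ.π φ ∈ τ.D.statesOn K
  states_close : ∀ φ ∈ τ.D.statesOn K, ∃ ψ ∈ τ.dom.statesBall (r + 4 * ε),
    τ.D.mkDist φ (pullback τ.π ψ) ≤ ENNReal.ofReal ε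
  target_nonempty : ∀ a ∈ τ.dom.locBall r, (τ.targetSet a (τ.dom.L a) r ε K).Nonempty
  target_top_nonempty : ∀ a ∈ τ.dom.locBall r, a ∈ τ.dom.M →
    (τ.targetSet a (τ.dom.L a) r ε K ∩ (τ.cod.M : Set τ.cod.carrier)).Nonempty
  lip_le : ∀ d ∈ τ.D.loc K, τ.cod.L (τ.ρ d) ≤ τ.D.L d

/-- `(ε, K)` is `r`-admissible (`ε > 0` and `K` is compact). -/
structure IsAdmissiblePair (r ε : ℝ) (K : Set τ.D.Spec) : Prop where
  pos : 0 < ε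
  isCompact : IsCompact K
  left : τ.IsLeftAdmissible r ε K
  right : τ.inv.IsLeftAdmissible r ε K
  base : τ.D.mkTop (fun m => τ.dom.pt ⟨τ.π m, τ.π_mem m m.2⟩)
    (fun m => τ.cod.pt ⟨τ.ρ m, τ.ρ_mem m m.2⟩) ≤ ENNReal.ofReal ε
  leibniz : τ.D.LeibnizOn (τ.D.loc K)

/-- `Adm(τ|r)`: the set of `r`-admissible numbers. -/
def adm (r : ℝ) : Set ℝ :=
  {ε | 0 < ε ∧ ∃ K : ℝ → Set τ.D.Spec,
    (∀ t ∈ Ioc 0 r, ∀ t' ∈ Ioc 0 r, t ≤ t' → K t ⊆ K t') ∧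
    ∀ t ∈ Ioc 0 r, τ.IsAdmissiblePair t ε (K t)}

/-- `τ` is an `r`-tunnel. -/
def IsTunnel (r : ℝ) : Prop := τ.IsPassage ∧ 0 < r ∧ (τ.adm r).Nonempty

/-- The `r`-extent of a passage (`∞` when there is no `r`-admissible number). -/
def extent (r : ℝ) : ℝ≥0∞ := ⨅ ε ∈ τ.adm r, ENNReal.ofReal ε

/-- The passage `(A, L_A, M_A, id, A, h, B)` of an isometric isomorphism `h`. -/
def ofIso {A B : PointedTriple.{u}} (h : A.carrier ≃⋆ₐ[ℂ] B.carrier)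
    (hh : IsIsometricIso A B h) : Passage.{u} where
  dom := A
  cod := B
  D := A.toLipTriple
  π := NonUnitalStarAlgHom.id ℂ A.carrier
  ρ := (h : A.carrier →⋆ₙₐ[ℂ] B.carrier)
  π_mem := fun _ hm => hm
  ρ_mem := hh.topographic.map_mem

/-- The passage `(B, L_B, M_B, id, B, h⁻¹, A)` of an isometric isomorphism `h : A → B`. -/
def ofIsoSymm {A B : PointedTriple.{u}} (h : A.carrier ≃⋆ₐ[ℂ] B.carrier)
    (hh : IsIsometricIso A B h) : Passage.{u} where
  dom := B
  cod := A
  D := B.toLipTriple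
  π := NonUnitalStarAlgHom.id ℂ B.carrier
  ρ := (h.symm : B.carrier →⋆ₙₐ[ℂ] A.carrier)
  π_mem := fun _ hm => hm
  ρ_mem := by
    intro m hm
    have hm' : m ∈ h '' (A.M : Set A.carrier) := by rw [hh.image_top]; exact hm
    obtain ⟨a, ha, rfl⟩ := hm'
    have : h.symm (h a) = a := h.symm_apply_apply a
    change h.symm (h a) ∈ A.M
    rw [this]
    exact ha

end Passage

/-! ### Weakly appropriate classes, propinquity, hypertopology -/

/-- The class `T` of passages is weakly appropriate for the class `C`. -/
structure WeaklyAppropriate (C : Set PointedTriple.{u}) (T : Set Passage.{u}) : Prop where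
  tunnel : ∀ τ ∈ T, τ.dom ∈ C ∧ τ.cod ∈ C ∧ ∃ r, τ.IsTunnel r
  inv : ∀ τ ∈ T, τ.inv ∈ T
  comp : ∀ τ₁ ∈ T, ∀ τ₂ ∈ T, τ₁.cod = τ₂.dom → ∀ r, τ₁.IsTunnel r → τ₂.IsTunnel r →
    ∀ ε₁ ε₂ : ℝ, τ₁.extent r < ENNReal.ofReal ε₁ → τ₂.extent r < ENNReal.ofReal ε₂ →
    ∀ t, 0 < t → t ≤ r - 4 * max ε₁ ε₂ → ∀ α : ℝ, 0 < α →
    ∃ τ ∈ T, τ.dom = τ₁.dom ∧ τ.cod = τ₂.cod ∧ τ.IsTunnel t ∧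
      τ.extent t ≤ ENNReal.ofReal (ε₁ + ε₂ + α)
  iso : ∀ A ∈ C, ∀ B ∈ C, ∀ (h : A.carrier ≃⋆ₐ[ℂ] B.carrier) (hh : IsIsometricIso A B h),
    Passage.ofIso h hh ∈ T ∧ Passage.ofIsoSymm h hh ∈ T

/-- The `r`-local propinquity (the infimum of the empty set being `∞`). -/
def localPropinquity (T : Set Passage.{u}) (r : ℝ) (A B : PointedTriple.{u}) : ℝ≥0∞ :=
  ⨅ (τ : Passage.{u}) (_ : τ ∈ T ∧ τ.dom = A ∧ τ.cod = B ∧ τ.IsTunnel r), τ.extent r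

/-- The topographic Gromov-Hausdorff propinquity. -/
def propinquity (T : Set Passage.{u}) (A B : PointedTriple.{u}) : ℝ :=
  (min (⨅ (ε : ℝ) (_ : 0 < ε ∧ localPropinquity T ε⁻¹ A B < ENNReal.ofReal ε), ENNReal.ofReal ε)
    (ENNReal.ofReal (√2 / 4))).toReal

/-- The closure operator of the hypertopology on `C`: limits in `C` of sequences of elements. -/
def hyperClosure (C : Set PointedTriple.{u}) (T : Set Passage.{u}) (S : Set PointedTriple.{u}) :
    Set PointedTriple.{u} :=
  {B | B ∈ C ∧ ∃ A : ℕ → PointedTriple.{u}, (∀ n, A n ∈ S) ∧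
    Tendsto (fun n => propinquity T (A n) B) atTop (𝓝 0)}

/-! ### Classical pointed proper metric spaces and Gromov-Hausdorff convergence -/

/-- Pointed proper metric spaces. -/
structure PointedProperSpace where
  carrier : Type u
  [metric : MetricSpace carrier]
  [proper : ProperSpace carrier]
  pt : carrier

attribute [instance] PointedProperSpace.metric PointedProperSpace.proper

/-- `B ⊆_ε A` in a metric space. -/
def AlmostSubset {Z : Type u} [MetricSpace Z] (ε : ℝ) (B A : Set Z) : Prop :=
  ∀ b ∈ B, ∃ a ∈ A, dist b a ≤ ε

/-- `δ_r((X, x), (Y, y))` for subsets `X`, `Y` of a metric space `Z`. -/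
def deltaR {Z : Type u} [MetricSpace Z] (r : ℝ) (X : Set Z) (x : Z) (Y : Set Z) (y : Z) : ℝ≥0∞ :=
  ⨅ (ε : ℝ) (_ : 0 < ε ∧ dist x y ≤ ε ∧ AlmostSubset ε (X ∩ Metric.closedBall x r) Y ∧
    AlmostSubset ε (Y ∩ Metric.closedBall y r) X), ENNReal.ofReal ε

/-- `Δ_r(X, Y)`: the infimum of `δ_r` over all isometric embeddings into metric spaces. -/
def DeltaR (r : ℝ) (X Y : PointedProperSpace.{u}) : ℝ≥0∞ :=
  ⨅ (Z : Type u) (_ : MetricSpace Z) (i : X.carrier → Z) (j : Y.carrier → Z)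
    (_ : Isometry i ∧ Isometry j), deltaR r (range i) (i X.pt) (range j) (j Y.pt)

/-- Gromov-Hausdorff convergence of pointed proper metric spaces. -/
def GHTendsto (X : ℕ → PointedProperSpace.{u}) (Y : PointedProperSpace.{u}) : Prop :=
  ∀ r : ℝ, 0 < r → Tendsto (fun n => DeltaR r (X n) Y) atTop (𝓝 0)

/-- The Lipschitz seminorm on `C₀(X)`, restricted to real-valued functions. -/
def lipSeminorm (X : Type u) [MetricSpace X] (f : C₀(X, ℂ)) : ℝ≥0∞ :=
  open Classical in
  if IsSelfAdjoint f then ⨆ (p : X) (q : X) (_ : p ≠ q), ‖f p - f q‖ₑ / edist p q else ∞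

/-- The triple `(C₀(X), L, C₀(X))`. -/
def classicalTriple (X : Type u) [MetricSpace X] : LipTriple.{u} where
  carrier := C₀(X, ℂ)
  L := lipSeminorm X
  M := ⊤

/-- Evaluation at a point as a continuous functional on `C₀(X)`. -/
def evalCLM {X : Type u} [MetricSpace X] (x : X) : C₀(X, ℂ) →L[ℂ] ℂ :=
  LinearMap.mkContinuous
    { toFun := fun f => f x, map_add' := fun _ _ => rfl, map_smul' := fun _ _ => rfl } 1 (by
      intro f
      rw [one_mul]
      exact f.toBCF.norm_coe_le_norm x)

theorem exists_ne_zero {X : Type u} [MetricSpace X] [ProperSpace X] (x : X) :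
    ∃ f : C₀(X, ℂ), f x ≠ 0 := by
  have hcont : Continuous fun p : X => ((max 0 (1 - dist p x) : ℝ) : ℂ) := by fun_prop
  have hsupp : HasCompactSupport fun p : X => ((max 0 (1 - dist p x) : ℝ) : ℂ) := by
    refine HasCompactSupport.intro (isCompact_closedBall x 1) fun p hp => ?_
    have h1 : 1 < dist p x := by simpa using hp
    rw [max_eq_left (by linarith), Complex.ofReal_zero]
  refine ⟨⟨⟨_, hcont⟩, hsupp.is_zero_at_infty⟩, ?_⟩
  change ((max 0 (1 - dist x x) : ℝ) : ℂ) ≠ 0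
  simp

/-- The point `x`, as a character of the topography `C₀(X)`. -/
def evalChar {X : Type u} [MetricSpace X] [ProperSpace X] (x : X) : (classicalTriple X).Spec :=
  ⟨StrongDual.toWeakDual ((evalCLM x).comp
      (⟨(⊤ : NonUnitalStarSubalgebra ℂ C₀(X, ℂ)).toNonUnitalSubalgebra.toSubmodule.subtype,
        continuous_subtype_val⟩ : (⊤ : NonUnitalStarSubalgebra ℂ C₀(X, ℂ)) →L[ℂ] C₀(X, ℂ))), by
    refine ⟨fun h => ?_, fun _ _ => rfl⟩
    obtain ⟨f, hf⟩ := exists_ne_zero x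
    exact hf (DFunLike.congr_fun h ⟨f, trivial⟩)⟩

/-- The pointed triple `(C₀(X), L, C₀(X), x)`. -/
def classical (X : PointedProperSpace.{u}) : PointedTriple.{u} where
  toLipTriple := classicalTriple X.carrier
  pt := evalChar X.pt

/-- The surjection `C₀(Z) → C₀(X)`, `f ↦ f ∘ ι`, of an isometric embedding `ι : X → Z`. -/
def restrictHom {X Z : Type u} [MetricSpace X] [ProperSpace X] [MetricSpace Z]
    (i : X → Z) (hi : Isometry i) : C₀(Z, ℂ) →⋆ₙₐ[ℂ] C₀(X, ℂ) :=
  { ZeroAtInftyContinuousMap.compNonUnitalAlgHom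
      (⟨⟨i, hi.continuous⟩, hi.isClosedEmbedding.tendsto_cocompact⟩ : CocompactMap X Z) with
    map_star' := fun _ => rfl }

/-- The passage `(C₀(Z), L_Z, C₀(Z), ι_X^*, X, ι_Y^*, Y)` of two isometric embeddings. -/
def classicalPassage (X Y : PointedProperSpace.{u}) (Z : Type u) [MetricSpace Z]
    (i : X.carrier → Z) (hi : Isometry i) (j : Y.carrier → Z) (hj : Isometry j) :
    Passage.{u} where
  dom := classical X
  cod := classical Y
  D := classicalTriple Z
  π := restrictHom i hi
  ρ := restrictHom j hj
  π_mem := fun _ _ => trivial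
  ρ_mem := fun _ _ => trivial

end

end TopoProp

open TopoProp

/-! Gromov-Hausdorff closeness places `X` and `Y` in one metric space `Z`, and `C₀(Z)` with the two
restriction maps is the candidate tunnel. Its compact set at radius `t` is the union of the two
balls of radius `t + s`, where `s` measures the closeness.

The delicate condition is the lift: a function on `X` supported in the ball of radius `t` must
extend to `Z` with the same Lipschitz constant and vanish off that compact set. McShane extension
does this once the function, extended by `0` to the far points of `Y`, is still Lipschitz. This
holds if every far point of `Y` is at least as far from a point `p` of the `t`-ball as some point of
`X` outside the ball (`IsHalfGluing.escape`). Two devices give this. Moving `X` and `Y` apart by an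
extra `η` pays for replacing a far point of `Y` by a nearby point of `X`. For points too remote to
have a neighbour, one fixed point of `X` outside the ball serves. Such a point comes from
non-compactness of `Y`; if all spaces lie in one bounded range, no remote points exist. Some
hypothesis is needed: on a compact `Y` the function `1` has seminorm `0`, so its lift is constant
and cannot vanish at far points of the other space. See `exists_lipschitz_extension` and
`isHalfGluing_of_separated`.

States carried by the compact set are moved to `X` by a partition of unity and nearest points
(`exists_state_close`).

That `C₀(X)` is a proper quantum metric space rests on three facts: the spectrum is `X` and its
Monge-Kantorovich metric is the distance (`specHomeo`, `mkTop_evalChar`); evaluation at an indicator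
projection is an infimum over cutoffs (`mem_statesOn_iff`, `mem_localSa_iff`); a tame set of states
is carried by one compact set (`exists_carrier_of_isTame`), where an Arzelà-Ascoli argument compares
the topologies. -/

namespace TopoProp

open scoped NNReal

noncomputable section

/-! ### Functions vanishing at infinity -/

section ZeroAtInfty

variable {X : Type u} [MetricSpace X]

theorem norm_le_iff {E : Type*} [NormedAddCommGroup E] (f : C₀(X, E)) {c : ℝ} (hc : 0 ≤ c) :
    ‖f‖ ≤ c ↔ ∀ x, ‖f x‖ ≤ c := by
  rw [← ZeroAtInftyContinuousMap.norm_toBCF_eq_norm]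
  exact BoundedContinuousFunction.norm_le hc

theorem norm_apply_le {E : Type*} [NormedAddCommGroup E] (f : C₀(X, E)) (x : X) :
    ‖f x‖ ≤ ‖f‖ := (norm_le_iff f (norm_nonneg f)).1 le_rfl x

/-- Post-composition with a continuous function fixing zero. -/
def postComp {E F : Type*} [NormedAddCommGroup E] [NormedAddCommGroup F] (g : E → F)
    (hg : Continuous g) (h0 : g 0 = 0) (f : C₀(X, E)) : C₀(X, F) :=
  ⟨⟨fun x => g (f x), by fun_prop⟩, by
    have := (hg.tendsto 0).comp f.zero_at_infty'
    rw [h0] at this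
    exact this⟩

/-- A real function vanishing at infinity, as a complex function. -/
def toC (f : C₀(X, ℝ)) : C₀(X, ℂ) := postComp _ Complex.continuous_ofReal Complex.ofReal_zero f

/-- The real part of a function vanishing at infinity. -/
def reC (f : C₀(X, ℂ)) : C₀(X, ℝ) := postComp _ Complex.continuous_re Complex.zero_re f

/-- The imaginary part of a function vanishing at infinity. -/
def imC (f : C₀(X, ℂ)) : C₀(X, ℝ) := postComp _ Complex.continuous_im Complex.zero_im f

@[simp] theorem toC_apply (f : C₀(X, ℝ)) (x : X) : toC f x = (f x : ℂ) := rfl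

@[simp] theorem reC_apply (f : C₀(X, ℂ)) (x : X) : reC f x = (f x).re := rfl

@[simp] theorem imC_apply (f : C₀(X, ℂ)) (x : X) : imC f x = (f x).im := rfl

theorem isSelfAdjoint_iff (f : C₀(X, ℂ)) : IsSelfAdjoint f ↔ ∀ x, (f x).im = 0 := by
  rw [IsSelfAdjoint, DFunLike.ext_iff]
  exact forall_congr' fun x => Complex.conj_eq_iff_im

theorem isSelfAdjoint_toC (f : C₀(X, ℝ)) : IsSelfAdjoint (toC f) :=
  (isSelfAdjoint_iff _).2 fun _ => Complex.ofReal_im _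

theorem toC_reC {f : C₀(X, ℂ)} (hf : IsSelfAdjoint f) : toC (reC f) = f := by
  ext x
  exact Complex.ext (by simp) (by simp [(isSelfAdjoint_iff f).1 hf x])

theorem toC_reC_add_imC (f : C₀(X, ℂ)) : toC (reC f) + Complex.I • toC (imC f) = f := by
  ext x
  exact Complex.ext (by simp) (by simp)

theorem toC_add (f g : C₀(X, ℝ)) : toC (f + g) = toC f + toC g := by ext x; simp

theorem toC_sub (f g : C₀(X, ℝ)) : toC (f - g) = toC f - toC g := by ext x; simp

theorem toC_smul (c : ℝ) (f : C₀(X, ℝ)) : toC (c • f) = (c : ℂ) • toC f := by ext x; simp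

theorem norm_toC (f : C₀(X, ℝ)) : ‖toC f‖ = ‖f‖ :=
  le_antisymm ((norm_le_iff _ (norm_nonneg _)).2 fun x => by simpa using norm_apply_le f x)
    ((norm_le_iff _ (norm_nonneg _)).2 fun x => by simpa using norm_apply_le (toC f) x)

/-- A continuous function vanishing off a compact set. -/
def ofCompact {E : Type*} [NormedAddCommGroup E] (g : X → E) (hg : Continuous g) {K : Set X}
    (hK : IsCompact K) (h : ∀ x ∉ K, g x = 0) : C₀(X, E) :=
  ⟨⟨g, hg⟩, (HasCompactSupport.intro hK fun x hx => h x hx).is_zero_at_infty⟩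

@[simp] theorem ofCompact_apply {E : Type*} [NormedAddCommGroup E] (g : X → E) (hg : Continuous g)
    {K : Set X} (hK : IsCompact K) (h : ∀ x ∉ K, g x = 0) (x : X) :
    ofCompact g hg hK h x = g x := rfl

theorem isCompact_le_norm {E : Type*} [NormedAddCommGroup E] (f : C₀(X, E)) {ε : ℝ}
    (hε : 0 < ε) : IsCompact {x | ε ≤ ‖f x‖} := by
  have h : ∀ᶠ x in cocompact X, ‖f x‖ < ε := by
    have := f.zero_at_infty'.norm
    rw [norm_zero] at this
    exact this.eventually_lt_const hε
  obtain ⟨K, hK, hKs⟩ := mem_cocompact.1 h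
  refine hK.of_isClosed_subset (isClosed_le continuous_const (by fun_prop)) fun x hx => ?_
  by_contra hxK
  exact (not_le.2 (show ‖f x‖ < ε from hKs hxK)) hx

/-- The tent function of height `N` at `x`. -/
def tent [ProperSpace X] (N : ℝ) (x : X) : C₀(X, ℝ) :=
  ofCompact (fun p => max 0 (N - dist p x)) (by fun_prop) (isCompact_closedBall x N) fun p hp => by
    have : N < dist p x := by simpa using hp
    exact max_eq_left (by linarith)

@[simp] theorem tent_apply [ProperSpace X] (N : ℝ) (x p : X) :
    tent N x p = max 0 (N - dist p x) := rfl

theorem lipschitzWith_tent [ProperSpace X] (N : ℝ) (x : X) : LipschitzWith 1 (tent N x) := by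
  have h : LipschitzWith 1 fun p : X => N - dist p x := by
    refine LipschitzWith.of_le_add fun p q => ?_
    have := dist_triangle q p x
    rw [dist_comm q p] at this
    linarith
  exact h.const_max 0

theorem exists_cutoff [ProperSpace X] {K T : Set X} (hK : IsCompact K) (hT : IsClosed T)
    (hd : Disjoint K T) :
    ∃ m : C₀(X, ℝ), (∀ x, m x ∈ Icc (0 : ℝ) 1) ∧ (∀ x ∈ K, m x = 1) ∧ ∀ x ∈ T, m x = 0 := by
  obtain ⟨f, h1, h0, hc, hI⟩ := exists_continuous_one_zero_of_isCompact hK hT hd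
  exact ⟨⟨f, hc.is_zero_at_infty⟩, hI, fun x hx => h1 hx, fun x hx => h0 hx⟩

end ZeroAtInfty

/-! ### The Lipschitz seminorm -/

section Lip

variable {X : Type u} [MetricSpace X]

/-- The bridge to `LipschitzWith`: pairs `p = q`, absent from the supremum, impose no condition.
Later estimates split off the value `∞` and then argue with a finite constant. -/
theorem lipSeminorm_le_iff (f : C₀(X, ℂ)) (l : ℝ≥0) :
    lipSeminorm X f ≤ l ↔ IsSelfAdjoint f ∧ LipschitzWith l f := by
  unfold lipSeminorm
  split_ifs with hf
  · simp only [hf, true_and, iSup_le_iff]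
    refine forall_congr' fun p => forall_congr' fun q => ?_
    rw [edist_eq_enorm_sub]
    by_cases h : p = q
    · simp [h]
    · simp only [ne_eq, h, not_false_eq_true, true_implies]
      exact ENNReal.div_le_iff (edist_pos.2 h).ne' (edist_ne_top _ _)
  · simp [hf]

theorem lipschitzWith_toC_iff (f : C₀(X, ℝ)) (l : ℝ≥0) :
    LipschitzWith l (toC f) ↔ LipschitzWith l f := by
  refine forall_congr' fun p => forall_congr' fun q => ?_
  have : edist (toC f p) (toC f q) = edist (f p) (f q) := by
    simpa using Complex.isometry_ofReal.edist_eq (f p) (f q)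
  rw [this]

theorem lipSeminorm_toC_le_iff (f : C₀(X, ℝ)) (l : ℝ≥0) :
    lipSeminorm X (toC f) ≤ l ↔ LipschitzWith l f := by
  rw [lipSeminorm_le_iff, lipschitzWith_toC_iff, and_iff_right (isSelfAdjoint_toC f)]

theorem lipSeminorm_lt_top {f : C₀(X, ℂ)} (h : lipSeminorm X f < ∞) :
    ∃ l : ℝ≥0, lipSeminorm X f = l ∧ IsSelfAdjoint f ∧ LipschitzWith l f := by
  lift lipSeminorm X f to ℝ≥0 using h.ne with l hl
  exact ⟨l, rfl, (lipSeminorm_le_iff f l).1 hl.ge⟩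

theorem le_lipSeminorm_of {f : C₀(X, ℂ)} {b : ℝ≥0∞}
    (h : ∀ l : ℝ≥0, b = l → IsSelfAdjoint f ∧ LipschitzWith l f) : lipSeminorm X f ≤ b := by
  induction b with
  | top => exact le_top
  | coe l => exact (lipSeminorm_le_iff f l).2 (h l rfl)

theorem lipSeminorm_zero : lipSeminorm X 0 = 0 := by
  have := (lipSeminorm_le_iff (0 : C₀(X, ℂ)) 0).2
    ⟨IsSelfAdjoint.zero _, LipschitzWith.const (0 : ℂ)⟩
  simpa using this

theorem lipSeminorm_add_le (f g : C₀(X, ℂ)) :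
    lipSeminorm X (f + g) ≤ lipSeminorm X f + lipSeminorm X g := by
  rcases eq_or_ne (lipSeminorm X f + lipSeminorm X g) ∞ with h | h
  · rw [h]; exact le_top
  obtain ⟨hf, hg⟩ := ENNReal.add_ne_top.1 h
  obtain ⟨l, hl, hfs, hfl⟩ := lipSeminorm_lt_top hf.lt_top
  obtain ⟨k, hk, hgs, hgl⟩ := lipSeminorm_lt_top hg.lt_top
  rw [hl, hk, ← ENNReal.coe_add]
  exact (lipSeminorm_le_iff _ _).2 ⟨hfs.add hgs, hfl.add hgl⟩

theorem lipSeminorm_smul_le (c : ℝ) (hc : c ≠ 0) (f : C₀(X, ℂ)) :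
    lipSeminorm X ((c : ℂ) • f) ≤ ENNReal.ofReal |c| * lipSeminorm X f := by
  rcases eq_or_ne (lipSeminorm X f) ∞ with h | h
  · rw [h, ENNReal.mul_top (by simpa using hc)]; exact le_top
  obtain ⟨l, hl, hfs, hfl⟩ := lipSeminorm_lt_top h.lt_top
  rw [hl, ENNReal.ofReal, ← ENNReal.coe_mul, lipSeminorm_le_iff]
  refine ⟨(isSelfAdjoint_iff _).2 fun x => ?_, ?_⟩
  · simp [(isSelfAdjoint_iff f).1 hfs x]
  · have := (lipschitzWith_smul (β := ℂ) (c : ℂ)).comp hfl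
    have e : ‖(c : ℂ)‖₊ = Real.toNNReal |c| := by ext; simp
    rw [e] at this
    exact this

theorem lipSeminorm_smul (c : ℝ) (f : C₀(X, ℂ)) :
    lipSeminorm X ((c : ℂ) • f) = ENNReal.ofReal |c| * lipSeminorm X f := by
  rcases eq_or_ne c 0 with rfl | hc
  · simp [lipSeminorm_zero]
  refine le_antisymm (lipSeminorm_smul_le c hc f) ?_
  have h := lipSeminorm_smul_le c⁻¹ (inv_ne_zero hc) ((c : ℂ) • f)
  rw [smul_smul, ← Complex.ofReal_mul, inv_mul_cancel₀ hc, Complex.ofReal_one, one_smul] at h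
  calc _ ≤ ENNReal.ofReal |c| * (ENNReal.ofReal |c⁻¹| * lipSeminorm X ((c : ℂ) • f)) := by gcongr
    _ = _ := by
      rw [← mul_assoc, ← ENNReal.ofReal_mul (abs_nonneg c), ← abs_mul, mul_inv_cancel₀ hc]
      simp

theorem lipSeminorm_mul_le {f g : C₀(X, ℂ)} :
    lipSeminorm X (f * g) ≤ ‖f‖ₑ * lipSeminorm X g + lipSeminorm X f * ‖g‖ₑ := by
  -- Since `0 * ∞ = 0`, an infinite seminorm makes the right-hand side infinite only against a
  -- factor of non-zero norm; zero factors are therefore treated separately.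
  have h0 : ∀ {h : C₀(X, ℂ)}, h ≠ 0 → ‖h‖ₑ ≠ 0 := fun {h} hh h' => hh <|
    ZeroAtInftyContinuousMap.ext fun x => norm_le_zero_iff.1 <|
      (norm_apply_le h x).trans_eq (by simpa using congrArg ENNReal.toReal h')
  rcases eq_or_ne f 0 with rfl | hf0
  · rw [zero_mul, lipSeminorm_zero]; exact bot_le
  rcases eq_or_ne g 0 with rfl | hg0
  · rw [mul_zero, lipSeminorm_zero]; exact bot_le
  rcases eq_or_ne (lipSeminorm X f) ∞ with h | hf
  · rw [h, ENNReal.top_mul (h0 hg0), add_top]; exact le_top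
  rcases eq_or_ne (lipSeminorm X g) ∞ with h | hg
  · rw [h, ENNReal.mul_top (h0 hf0), top_add]; exact le_top
  obtain ⟨l, hl, hfs, hfl⟩ := lipSeminorm_lt_top hf.lt_top
  obtain ⟨k, hk, hgs, hgl⟩ := lipSeminorm_lt_top hg.lt_top
  rw [hl, hk, enorm_eq_nnnorm, enorm_eq_nnnorm, ← ENNReal.coe_mul, ← ENNReal.coe_mul,
    ← ENNReal.coe_add, lipSeminorm_le_iff]
  rw [isSelfAdjoint_iff] at hfs hgs ⊢
  refine ⟨fun x => by simp [hfs x, hgs x], LipschitzWith.of_dist_le_mul fun p q => ?_⟩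
  have h1 := hfl.dist_le_mul p q
  have h2 := hgl.dist_le_mul p q
  rw [dist_eq_norm] at h1 h2 ⊢
  have e : (f * g) p - (f * g) q = f p * (g p - g q) + (f p - f q) * g q := by
    simp only [ZeroAtInftyContinuousMap.mul_apply]; ring
  rw [e]
  refine (norm_add_le _ _).trans ?_
  rw [norm_mul, norm_mul]
  have h3 := mul_le_mul (norm_apply_le f p) h2 (norm_nonneg _) (norm_nonneg _)
  have h4 := mul_le_mul h1 (norm_apply_le g q) (norm_nonneg _) (by positivity)
  push_cast
  linarith

/-- Both sides say that `f` is a real constant. For the converse, `f * b = c • b` is read at a point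
where `b` does not vanish. Compact and non-compact `X` need no distinction. -/
theorem lipSeminorm_eq_zero_iff [ProperSpace X] (f : C₀(X, ℂ)) :
    lipSeminorm X f = 0 ↔ IsSelfAdjoint f ∧ IsRealScalar f := by
  have h0 := lipSeminorm_le_iff f 0
  rw [ENNReal.coe_zero, nonpos_iff_eq_zero] at h0
  rw [h0, and_congr_right_iff]
  intro hf
  constructor
  · intro h
    rcases isEmpty_or_nonempty X with hX | ⟨⟨x⟩⟩
    · exact ⟨0, fun b => ⟨ZeroAtInftyContinuousMap.ext fun x => hX.elim x,
        ZeroAtInftyContinuousMap.ext fun x => hX.elim x⟩⟩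
    · have hc : ∀ p, f p = ((f x).re : ℂ) := fun p => by
        have h1 := h.dist_le_mul p x
        rw [NNReal.coe_zero, zero_mul] at h1
        rw [dist_le_zero.1 h1]
        exact Complex.ext (by simp) (by simp [(isSelfAdjoint_iff f).1 hf x])
      refine ⟨(f x).re, fun b => ⟨?_, ?_⟩⟩
      · ext p; simp [hc p]
      · ext p; simp [hc p, mul_comm]
  · rintro ⟨c, hc⟩
    have hfc : ∀ p, f p = c := fun p => by
      obtain ⟨b, hb⟩ := exists_ne_zero p
      have := DFunLike.congr_fun (hc b).1 p
      simp only [ZeroAtInftyContinuousMap.mul_apply, ZeroAtInftyContinuousMap.smul_apply,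
        smul_eq_mul] at this
      exact mul_right_cancel₀ hb this
    exact LipschitzWith.of_dist_le_mul fun p q => by simp [hfc]

theorem continuous_apply_zeroAtInfty (p : X) : Continuous fun f : C₀(X, ℂ) => f p :=
  (evalCLM p).continuous

/-- On self-adjoint elements the seminorm is a supremum of the continuous functions `f ↦ |f p - f q|
/ d(p, q)`. -/
theorem lowerSemicontinuousOn_lipSeminorm :
    LowerSemicontinuousOn (lipSeminorm X) {a | IsSelfAdjoint a} := by
  have h : LowerSemicontinuousOn (fun f : C₀(X, ℂ) =>
      ⨆ (p : X) (q : X) (_ : p ≠ q), ‖f p - f q‖ₑ / edist p q) {a | IsSelfAdjoint a} := by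
    refine lowerSemicontinuousOn_iSup fun p => lowerSemicontinuousOn_iSup fun q =>
      lowerSemicontinuousOn_iSup fun hpq =>
        (Continuous.lowerSemicontinuous ?_).lowerSemicontinuousOn _
    exact (ENNReal.continuous_div_const _ (edist_pos.2 hpq).ne').comp
      ((continuous_apply_zeroAtInfty p).sub (continuous_apply_zeroAtInfty q)).enorm
  intro f hf c hc
  have hc' := hc
  rw [lipSeminorm, if_pos (show IsSelfAdjoint f from hf)] at hc'
  filter_upwards [h f hf c hc', self_mem_nhdsWithin] with g hg hgs
  rw [lipSeminorm, if_pos (show IsSelfAdjoint g from hgs)]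
  exact hg

end Lip

/-! ### Density of the compactly supported Lipschitz functions -/

section Density

variable {X : Type u} [MetricSpace X]

/-- The approximant is the inf-convolution of `f` with `l * dist`. The slope `l = 2‖f‖/δ` is so
steep that points `y` beyond the `δ` of uniform continuity cannot undercut the value at `x`. -/
theorem exists_lipschitz_approx (f : C₀(X, ℝ)) {ε : ℝ} (hε : 0 < ε) :
    ∃ (h : X → ℝ) (l : ℝ≥0), LipschitzWith l h ∧ ∀ x, |f x - h x| ≤ ε := by
  obtain ⟨δ, hδ, hfδ⟩ := Metric.uniformContinuous_iff.1
    (ZeroAtInftyContinuousMap.uniformContinuous f) ε hε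
  set l : ℝ≥0 := Real.toNNReal (2 * ‖f‖ / δ) with hl
  have hl' : (l : ℝ) * δ = 2 * ‖f‖ := by
    rw [hl, Real.coe_toNNReal _ (by positivity)]
    field_simp
  have hb : ∀ x, |f x| ≤ ‖f‖ := fun x => norm_apply_le f x
  have hbdd : ∀ x, BddBelow (range fun y => f y + l * dist x y) := fun x =>
    ⟨-‖f‖, by
      rintro _ ⟨y, rfl⟩
      have := (abs_le.1 (hb y)).1
      have : 0 ≤ (l : ℝ) * dist x y := by positivity
      dsimp only
      linarith⟩
  refine ⟨fun x => ⨅ y, (f y + l * dist x y), l, LipschitzWith.of_le_add_mul l fun x y => ?_,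
    fun x => ?_⟩
  · have : Nonempty X := ⟨x⟩
    rw [← sub_le_iff_le_add]
    refine le_ciInf fun z => ?_
    have h1 := ciInf_le (hbdd x) z
    have h2 := mul_le_mul_of_nonneg_left (dist_triangle x y z) l.coe_nonneg
    linarith
  · have : Nonempty X := ⟨x⟩
    have h1 : (⨅ y, (f y + l * dist x y)) ≤ f x := by simpa using ciInf_le (hbdd x) x
    have h2 : f x - ε ≤ ⨅ y, (f y + l * dist x y) := by
      refine le_ciInf fun y => ?_
      have h0 : 0 ≤ (l : ℝ) * dist x y := by positivity
      rcases lt_or_ge (dist x y) δ with h | h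
      · have := hfδ h
        rw [Real.dist_eq] at this
        have := (abs_lt.1 this).2
        linarith
      · have h3 := mul_le_mul_of_nonneg_left h l.coe_nonneg
        rw [hl'] at h3
        have := (abs_le.1 (hb y)).1
        have := (abs_le.1 (hb x)).2
        linarith
    rw [abs_le]
    constructor <;> linarith

/-- The compactly supported real Lipschitz functions. -/
def lipCompact (X : Type u) [MetricSpace X] : Set C₀(X, ℝ) :=
  {g | (∃ l : ℝ≥0, LipschitzWith l g) ∧ ∃ K, IsCompact K ∧ ∀ x ∉ K, g x = 0}

/-- Soft thresholding: off the compact set `{ε/4 ≤ ‖f‖}` the Lipschitz approximant is at most `ε/2`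
in absolute value, so subtracting its truncation to `[-ε/2, ε/2]` kills it there. The total error is
at most `ε/4 + ε/2`. -/
theorem exists_lipCompact_approx (f : C₀(X, ℝ)) {ε : ℝ} (hε : 0 < ε) :
    ∃ g ∈ lipCompact X, ‖f - g‖ ≤ ε := by
  obtain ⟨h, l, hl, hfh⟩ := exists_lipschitz_approx f (show 0 < ε / 4 by positivity)
  set e := ε / 2 with he
  have he0 : 0 < e := by positivity
  have hK := isCompact_le_norm f (show 0 < ε / 4 by positivity)
  have h1 : LipschitzWith 1 fun t : ℝ => t - max (-e) (min e t) := by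
    refine LipschitzWith.of_dist_le_mul fun a b => ?_
    rw [Real.dist_eq, Real.dist_eq, NNReal.coe_one, one_mul]
    rcases max_cases (-e) (min e a) with ha | ha <;> rcases max_cases (-e) (min e b) with hb | hb <;>
    rcases min_cases e a with ha' | ha' <;> rcases min_cases e b with hb' | hb' <;>
    rw [ha.1, hb.1] <;> rw [abs_le] <;> rcases abs_cases (a - b) with hab | hab <;>
    constructor <;> linarith
  have h2 : LipschitzWith l fun x => h x - max (-e) (min e (h x)) := by
    simpa using! h1.comp hl
  have h3 : ∀ x ∉ {x | ε / 4 ≤ ‖f x‖}, h x - max (-e) (min e (h x)) = 0 := by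
    intro x hx
    have hx' : |f x| < ε / 4 := by simpa using hx
    have h4 := abs_le.1 (hfh x)
    have h5 := abs_lt.1 hx'
    rw [min_eq_right (by linarith), max_eq_right (by linarith), sub_self]
  refine ⟨ofCompact _ h2.continuous hK h3, ⟨⟨l, h2⟩, _, hK, h3⟩,
    (norm_le_iff _ hε.le).2 fun x => ?_⟩
  have h4 := abs_le.1 (hfh x)
  rw [Real.norm_eq_abs, ZeroAtInftyContinuousMap.sub_apply, ofCompact_apply]
  rcases max_cases (-e) (min e (h x)) with ha | ha <;> rcases min_cases e (h x) with ha' | ha' <;>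
    rw [abs_le] <;> constructor <;> linarith

theorem mem_closure_lipCompact {f : C₀(X, ℂ)} (hf : IsSelfAdjoint f) :
    f ∈ closure (toC '' lipCompact X) := by
  refine Metric.mem_closure_iff.2 fun ε hε => ?_
  obtain ⟨g, hg, hfg⟩ := exists_lipCompact_approx (reC f) (half_pos hε)
  refine ⟨toC g, mem_image_of_mem _ hg, ?_⟩
  rw [dist_eq_norm, ← toC_reC hf, ← toC_sub, norm_toC]
  linarith

theorem eq_zero_of_lipCompact {φ : C₀(X, ℂ) →L[ℂ] ℂ} (h : ∀ g ∈ lipCompact X, φ (toC g) = 0)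
    (f : C₀(X, ℂ)) : φ f = 0 := by
  have key : ∀ g : C₀(X, ℝ), φ (toC g) = 0 := fun g => by
    have hcl : IsClosed {a : C₀(X, ℂ) | φ a = 0} := isClosed_eq φ.continuous continuous_const
    refine closure_minimal ?_ hcl (mem_closure_lipCompact (isSelfAdjoint_toC g))
    rintro _ ⟨k, hk, rfl⟩
    exact h k hk
  rw [← toC_reC_add_imC f, map_add, map_smul, key, key, smul_zero, add_zero]

end Density

theorem properSpace_induced {S X : Type*} [MetricSpace X] [ProperSpace X] (e : S ≃ X) :
    @ProperSpace S (MetricSpace.induced e e.injective inferInstance).toPseudoMetricSpace := by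
  let _ : MetricSpace S := MetricSpace.induced e e.injective inferInstance
  let E : S ≃ᵢ X := ⟨e, fun _ _ => rfl⟩
  refine ⟨fun x r => ?_⟩
  rw [show Metric.closedBall x r = E.toHomeomorph ⁻¹' Metric.closedBall (e x) r from rfl]
  exact E.toHomeomorph.isCompact_preimage.2 (isCompact_closedBall _ _)

/-! ### The spectrum of the classical topography -/

section Spectrum

variable {X : Type u} [MetricSpace X]

/-- A character of the topography, as a functional on the whole algebra. -/
def charCLM (χ : (classicalTriple X).Spec) : C₀(X, ℂ) →L[ℂ] ℂ where
  toFun f := χ ⟨f, trivial⟩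
  map_add' f g := map_add χ ⟨f, trivial⟩ ⟨g, trivial⟩
  map_smul' c f := map_smul χ c ⟨f, trivial⟩
  cont := (map_continuous χ).comp (continuous_id.subtype_mk fun _ => trivial)

theorem charCLM_mul (χ : (classicalTriple X).Spec) (f g : C₀(X, ℂ)) :
    charCLM χ (f * g) = charCLM χ f * charCLM χ g :=
  map_mul χ (⟨f, trivial⟩ : (classicalTriple X).M) ⟨g, trivial⟩

theorem charCLM_ne_zero (χ : (classicalTriple X).Spec) : ∃ f, charCLM χ f ≠ 0 := by
  by_contra! h
  exact χ.2.1 (DFunLike.ext _ _ fun m => h m.1)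

/-- The kernel of a character is an ideal, so it contains `|f|²` along with `f`; compactness of `K`
lets finitely many such functions be added up. -/
theorem exists_pos_of_vanishing (χ : (classicalTriple X).Spec)
    (h : ∀ x, ∃ f, charCLM χ f = 0 ∧ f x ≠ 0) {K : Set X} (hK : IsCompact K) :
    ∃ F : C₀(X, ℝ), charCLM χ (toC F) = 0 ∧ (∀ x, 0 ≤ F x) ∧ ∀ x ∈ K, 0 < F x := by
  refine hK.induction_on (p := fun s => ∃ F : C₀(X, ℝ), charCLM χ (toC F) = 0 ∧ (∀ x, 0 ≤ F x) ∧
    ∀ x ∈ s, 0 < F x) ?_ ?_ ?_ ?_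
  · refine ⟨0, ?_, fun x => le_rfl, fun x hx => hx.elim⟩
    have : toC (0 : C₀(X, ℝ)) = 0 := by ext; simp
    rw [this, map_zero]
  · rintro s t hst ⟨F, h1, h2, h3⟩
    exact ⟨F, h1, h2, fun x hx => h3 x (hst hx)⟩
  · rintro s t ⟨F, h1, h2, h3⟩ ⟨G, k1, k2, k3⟩
    refine ⟨F + G, by rw [toC_add, map_add, h1, k1, add_zero], fun x => add_nonneg (h2 x) (k2 x),
      fun x hx => ?_⟩
    rcases hx with hx | hx
    · exact add_pos_of_pos_of_nonneg (h3 x hx) (k2 x)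
    · exact add_pos_of_nonneg_of_pos (h2 x) (k3 x hx)
  · intro x _
    obtain ⟨f, hf, hx⟩ := h x
    refine ⟨{y | f y ≠ 0}, mem_nhdsWithin_of_mem_nhds
      ((isOpen_ne_fun (map_continuous f) continuous_const).mem_nhds hx), reC (star f * f), ?_,
      fun y => ?_, fun y hy => ?_⟩
    · rw [toC_reC (IsSelfAdjoint.star_mul_self f), charCLM_mul, hf, mul_zero]
    · simp only [reC_apply, ZeroAtInftyContinuousMap.mul_apply, ZeroAtInftyContinuousMap.star_apply,
        RCLike.star_def, ← Complex.normSq_eq_conj_mul_self, Complex.ofReal_re]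
      exact Complex.normSq_nonneg _
    · simp only [reC_apply, ZeroAtInftyContinuousMap.mul_apply, ZeroAtInftyContinuousMap.star_apply,
        RCLike.star_def, ← Complex.normSq_eq_conj_mul_self, Complex.ofReal_re]
      exact Complex.normSq_pos.2 hy

/-- If the kernel had no common zero, it would contain some `F` positive on `K`, hence every `g = F
* (g / F)` vanishing off `K`; by density the character would be zero. -/
theorem exists_charCLM_zero_imp (χ : (classicalTriple X).Spec) :
    ∃ x, ∀ f, charCLM χ f = 0 → f x = 0 := by
  by_contra! h
  obtain ⟨f, hf⟩ := charCLM_ne_zero χ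
  refine hf (eq_zero_of_lipCompact (fun g hg => ?_) f)
  obtain ⟨-, K, hK, hgK⟩ := hg
  obtain ⟨F, hF, -, hFK⟩ := exists_pos_of_vanishing χ h hK
  obtain ⟨c, hc, hcF⟩ : ∃ c : ℝ, 0 < c ∧ ∀ x ∈ K, c ≤ F x := by
    rcases K.eq_empty_or_nonempty with rfl | hne
    · exact ⟨1, one_pos, fun x hx => hx.elim⟩
    · obtain ⟨x, hx, hmin⟩ := hK.exists_isMinOn hne (map_continuous F).continuousOn
      exact ⟨F x, hFK x hx, fun y hy => hmin hy⟩
  have hpos : ∀ x, 0 < max (F x) c := fun x => lt_max_of_lt_right hc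
  -- Replacing `F` by `max F c` changes nothing on `K` and keeps the quotient continuous where `F`
  -- may vanish.
  have hcont : Continuous fun x => g x / max (F x) c :=
    (map_continuous g).div ((map_continuous F).max continuous_const) fun x => (hpos x).ne'
  have e : toC g = toC F * toC (ofCompact (fun x => g x / max (F x) c) hcont hK
      fun x hx => by rw [hgK x hx, zero_div]) := by
    ext x
    simp only [toC_apply, ZeroAtInftyContinuousMap.mul_apply, ofCompact_apply]
    rw [← Complex.ofReal_mul]
    congr 1
    by_cases hx : x ∈ K
    · rw [max_eq_left (hcF x hx), mul_div_cancel₀ _ (hFK x hx).ne']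
    · rw [hgK x hx, zero_div, mul_zero]
  rw [e, charCLM_mul, hF, zero_mul]

variable [ProperSpace X]

theorem evalChar_surjective : Function.Surjective (evalChar : X → (classicalTriple X).Spec) := by
  intro χ
  obtain ⟨x, hx⟩ := exists_charCLM_zero_imp χ
  obtain ⟨u, hu⟩ := charCLM_ne_zero χ
  -- The combination `χ(u) f - χ(f) u` lies in the kernel, hence vanishes at `x`. Thus `χ` is
  -- proportional to evaluation at `x`, and `f = u * u` shows that the factor is `1`.
  have h1 : ∀ f, charCLM χ u * f x = charCLM χ f * u x := fun f => by
    have := hx (charCLM χ u • f - charCLM χ f • u) (by simp [mul_comm])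
    simpa [sub_eq_zero] using this
  have hux : u x ≠ 0 := fun h0 => by
    obtain ⟨b, hb⟩ := exists_ne_zero x
    have := h1 b
    rw [h0, mul_zero] at this
    exact (mul_ne_zero hu hb) this
  have h2 : u x = charCLM χ u := by
    have := h1 (u * u)
    rw [charCLM_mul, ZeroAtInftyContinuousMap.mul_apply, ← mul_assoc] at this
    have h3 := mul_right_cancel₀ hux this
    exact mul_left_cancel₀ hu h3
  refine ⟨x, ?_⟩
  ext m
  have h4 := h1 m.1
  rw [h2, mul_comm] at h4
  exact mul_right_cancel₀ hu h4

theorem continuous_evalChar : Continuous (evalChar : X → (classicalTriple X).Spec) := by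
  refine Continuous.subtype_mk (WeakDual.continuous_of_continuous_eval fun m => ?_) _
  exact map_continuous (show C₀(X, ℂ) from m.1)

/-- The tent of height `ε` at `x` is positive exactly on the ball of radius `ε`, so its evaluation
detects that ball. -/
theorem isInducing_evalChar : IsInducing (evalChar : X → (classicalTriple X).Spec) := by
  refine isInducing_iff_nhds.2 fun x => le_antisymm
    (continuous_evalChar.tendsto x).le_comap ?_
  refine (Metric.nhds_basis_ball.ge_iff).2 fun ε hε => ?_
  have hc : Continuous fun χ : (classicalTriple X).Spec => (χ ⟨toC (tent ε x), trivial⟩).re :=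
    Complex.continuous_re.comp
      ((WeakDual.eval_continuous (⟨toC (tent ε x), trivial⟩ : (classicalTriple X).M)).comp
        continuous_subtype_val)
  refine mem_comap.2 ⟨_, IsOpen.mem_nhds (x := evalChar x)
    (isOpen_lt continuous_const hc) (?_ : (0 : ℝ) < _), fun y hy => ?_⟩
  · change 0 < ((tent ε x x : ℝ) : ℂ).re
    simpa using hε
  · have : 0 < ((tent ε x y : ℝ) : ℂ).re := hy
    simpa using this

theorem evalChar_injective : Function.Injective (evalChar : X → (classicalTriple X).Spec) :=
  isInducing_evalChar.injective

/-- The spectrum of the classical topography is the underlying space. -/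
def specHomeo : X ≃ₜ (classicalTriple X).Spec :=
  (Equiv.ofBijective evalChar ⟨evalChar_injective, evalChar_surjective⟩).toHomeomorphOfIsInducing
    isInducing_evalChar

theorem isCompact_preimage_evalChar {K : Set (classicalTriple X).Spec} (hK : IsCompact K) :
    IsCompact (evalChar ⁻¹' K : Set X) :=
  specHomeo.isCompact_preimage.2 hK

/-- The supremum is attained at the tent of height `dist x y` at `x`, which vanishes at `y`. -/
theorem mkTop_evalChar (x y : X) :
    (classicalTriple X).mkTop (evalChar x) (evalChar y) = edist x y := by
  refine le_antisymm (iSup₂_le fun m hm => ?_) ?_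
  · have h := ((lipSeminorm_le_iff (show C₀(X, ℂ) from m.1) 1).1 hm.2).2 x y
    rw [edist_eq_enorm_sub, ENNReal.coe_one, one_mul] at h
    exact h
  · refine le_trans ?_ (le_iSup₂ (⟨toC (tent (dist x y) x), trivial⟩ : (classicalTriple X).M)
      ⟨isSelfAdjoint_toC _, (lipSeminorm_toC_le_iff _ 1).2 (lipschitzWith_tent _ x)⟩)
    change _ ≤ ‖((tent (dist x y) x x : ℝ) : ℂ) - ((tent (dist x y) x y : ℝ) : ℂ)‖ₑ
    rw [edist_dist, tent_apply, tent_apply, dist_comm y x]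
    simp only [dist_self, sub_zero, sub_self, max_self, Complex.ofReal_zero]
    rw [max_eq_right dist_nonneg, ← ofReal_norm, Complex.norm_real, Real.norm_eq_abs,
      abs_of_nonneg dist_nonneg]

theorem evalChar_mem_specBall_iff (x y : X) {r : ℝ} (hr : 0 ≤ r) :
    evalChar x ∈ (classicalTriple X).specBall (evalChar y) r ↔ dist x y ≤ r := by
  change (classicalTriple X).mkTop _ _ ≤ _ ↔ _
  rw [mkTop_evalChar, edist_dist, ENNReal.ofReal_le_ofReal_iff hr]

theorem specBall_eq_image (y : X) {r : ℝ} (hr : 0 ≤ r) :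
    (classicalTriple X).specBall (evalChar y) r = evalChar '' Metric.closedBall y r := by
  ext χ
  obtain ⟨x, rfl⟩ := evalChar_surjective χ
  rw [evalChar_mem_specBall_iff x y hr, evalChar_injective.mem_set_image, Metric.mem_closedBall]

theorem spec_proper_classical : ∃ d : MetricSpace (classicalTriple X).Spec,
    (∀ χ ξ : (classicalTriple X).Spec,
      ENNReal.ofReal (d.dist χ ξ) = (classicalTriple X).mkTop χ ξ) ∧
    @ProperSpace (classicalTriple X).Spec d.toPseudoMetricSpace := by
  let e : (classicalTriple X).Spec ≃ X := specHomeo.symm.toEquiv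
  let d : MetricSpace (classicalTriple X).Spec := MetricSpace.induced e e.injective inferInstance
  refine ⟨d, fun χ ξ => ?_, ?_⟩
  · obtain ⟨x, rfl⟩ := evalChar_surjective χ
    obtain ⟨y, rfl⟩ := evalChar_surjective ξ
    rw [mkTop_evalChar, edist_dist]
    have h : ∀ z : X, e (evalChar z) = z := fun z => specHomeo.symm_apply_apply z
    change ENNReal.ofReal (dist (e (evalChar x)) (e (evalChar y))) = _
    rw [h, h]
  · exact properSpace_induced e

end Spectrum

/-! ### States of `C₀(X)` -/

section States

variable {X : Type u} [MetricSpace X]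

/-- A functional on `C₀(X)`, restricted to the real functions. -/
def reEval (φ : WeakDual ℂ C₀(X, ℂ)) : C₀(X, ℝ) →ₗ[ℝ] ℝ where
  toFun g := (φ (toC g)).re
  map_add' f g := by rw [toC_add, map_add, Complex.add_re]
  map_smul' c f := by
    rw [toC_smul, map_smul, smul_eq_mul, Complex.re_ofReal_mul, RingHom.id_apply, smul_eq_mul]

theorem toC_mul (f g : C₀(X, ℝ)) : toC (f * g) = toC f * toC g := by ext x; simp

/-- The positive part of a real function. -/
def posPartC (g : C₀(X, ℝ)) : C₀(X, ℝ) :=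
  postComp (fun t => max t 0) (by fun_prop) (max_self 0) g

@[simp] theorem posPartC_apply (g : C₀(X, ℝ)) (x : X) : posPartC g x = max (g x) 0 := rfl

variable {φ ψ : WeakDual ℂ C₀(X, ℂ)}

theorem apply_toC_nonneg (hφ : φ ∈ stateSpace C₀(X, ℂ)) {g : C₀(X, ℝ)} (hg : ∀ x, 0 ≤ g x) :
    0 ≤ φ (toC g) := by
  have h := hφ.1 (toC (postComp Real.sqrt Real.continuous_sqrt Real.sqrt_zero g))
  convert h using 2
  ext x
  change (g x : ℂ) = star ((Real.sqrt (g x) : ℝ) : ℂ) * ((Real.sqrt (g x) : ℝ) : ℂ)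
  rw [RCLike.star_def, Complex.conj_ofReal, ← Complex.ofReal_mul, Real.mul_self_sqrt (hg x)]

theorem apply_toC (hφ : φ ∈ stateSpace C₀(X, ℂ)) (g : C₀(X, ℝ)) :
    φ (toC g) = (reEval φ g : ℂ) := by
  have key : ∀ f : C₀(X, ℝ), (∀ x, 0 ≤ f x) → (φ (toC f)).im = 0 := fun f hf =>
    (Complex.le_def.1 (apply_toC_nonneg hφ hf)).2.symm
  have e : g = posPartC g - posPartC (-g) := by
    ext x
    simp only [ZeroAtInftyContinuousMap.sub_apply, posPartC_apply, ZeroAtInftyContinuousMap.neg_apply]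
    rcases max_cases (g x) 0 with h | h <;> rcases max_cases (-g x) 0 with h' | h' <;> linarith
  refine Complex.ext rfl ?_
  rw [Complex.ofReal_im, e, toC_sub, map_sub, Complex.sub_im, key _ fun x => le_max_right _ _,
    key _ fun x => le_max_right _ _, sub_zero]

theorem reEval_nonneg (hφ : φ ∈ stateSpace C₀(X, ℂ)) {g : C₀(X, ℝ)} (hg : ∀ x, 0 ≤ g x) :
    0 ≤ reEval φ g := (Complex.le_def.1 (apply_toC_nonneg hφ hg)).1

theorem reEval_mono (hφ : φ ∈ stateSpace C₀(X, ℂ)) {f g : C₀(X, ℝ)} (h : ∀ x, f x ≤ g x) :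
    reEval φ f ≤ reEval φ g := by
  rw [← sub_nonneg, ← map_sub]
  exact reEval_nonneg hφ fun x => sub_nonneg.2 (h x)

theorem norm_state_apply_le (hφ : φ ∈ stateSpace C₀(X, ℂ)) (f : C₀(X, ℂ)) : ‖φ f‖ ≤ ‖f‖ := by
  have := (WeakDual.toStrongDual φ).le_opNorm f
  rw [hφ.2, one_mul] at this
  exact this

theorem abs_reEval_le (hφ : φ ∈ stateSpace C₀(X, ℂ)) (g : C₀(X, ℝ)) : |reEval φ g| ≤ ‖g‖ := by
  rw [← norm_toC]
  exact (Complex.abs_re_le_norm _).trans (norm_state_apply_le hφ _)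

/-- The constant `c` need not belong to `C₀(X)`, so the bound goes through the norm of the positive
part; hence `0 ≤ c`. -/
theorem reEval_le (hφ : φ ∈ stateSpace C₀(X, ℂ)) {g : C₀(X, ℝ)} {c : ℝ} (hc : 0 ≤ c)
    (h : ∀ x, g x ≤ c) : reEval φ g ≤ c := by
  refine (reEval_mono hφ (g := posPartC g) fun x => le_max_left _ _).trans
    ((le_abs_self _).trans ((abs_reEval_le hφ _).trans ((norm_le_iff _ hc).2 fun x => ?_)))
  rw [posPartC_apply, Real.norm_of_nonneg (le_max_right _ _)]
  exact max_le (h x) hc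

theorem exists_reEval_gt (hφ : φ ∈ stateSpace C₀(X, ℂ)) {δ : ℝ} (hδ : 0 < δ) :
    ∃ g : C₀(X, ℝ), (∀ x, g x ≤ 1) ∧ 1 - δ < reEval φ g := by
  obtain ⟨f, hf, hfφ⟩ := (WeakDual.toStrongDual φ).exists_lt_apply_of_lt_opNorm
    (show 1 - δ < _ by rw [hφ.2]; linarith)
  change 1 - δ < ‖φ f‖ at hfφ
  -- The phase that makes `φ (u • f)` equal to `‖φ f‖`. If `φ f = 0`, division by zero gives `u = 0`
  -- and both identities below survive.
  set u : ℂ := (starRingEnd ℂ) (φ f) / ‖φ f‖ with hu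
  have hu1 : ‖u‖ ≤ 1 := by
    rw [hu, norm_div, RCLike.norm_conj, Complex.norm_real, norm_norm]
    exact div_self_le_one _
  have hu2 : φ (u • f) = (‖φ f‖ : ℂ) := by
    rw [map_smul, smul_eq_mul, hu, div_mul_eq_mul_div, mul_comm, Complex.mul_conj,
      Complex.normSq_eq_norm_sq, Complex.ofReal_pow, sq, mul_self_div_self]
  refine ⟨reC (u • f), fun x => ?_, ?_⟩
  · refine (Complex.re_le_norm _).trans ((norm_apply_le (u • f) x).trans ?_)
    rw [norm_smul]
    exact mul_le_one₀ hu1 (norm_nonneg _) hf.le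
  · have e := congrArg Complex.re (congrArg φ (toC_reC_add_imC (u • f)))
    rw [map_add, map_smul, apply_toC hφ, apply_toC hφ, hu2] at e
    simp at e
    rwa [e]

/-- The functions with values in `[0, 1]` which are equal to `1` on `K`. -/
def IsCutoff (K : Set X) (m : C₀(X, ℝ)) : Prop :=
  (∀ x, m x ∈ Icc (0 : ℝ) 1) ∧ ∀ x ∈ K, m x = 1

theorem exists_isCutoff_toC_eq {K : Set X} {f : C₀(X, ℂ)}
    (hI : ∀ x, ∃ s ∈ Icc (0 : ℝ) 1, f x = (s : ℂ)) (h1 : ∀ x ∈ K, f x = 1) :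
    ∃ g, IsCutoff K g ∧ toC g = f := by
  refine ⟨reC f, ⟨fun x => ?_, fun x hx => ?_⟩, toC_reC ((isSelfAdjoint_iff _).2 fun x => ?_)⟩
  · obtain ⟨s, hsI, hs⟩ := hI x
    rwa [reC_apply, hs, Complex.ofReal_re]
  · rw [reC_apply, h1 x hx, Complex.one_re]
  · obtain ⟨s, -, hs⟩ := hI x
    rw [hs, Complex.ofReal_im]

/-- The functional is carried by `K`: it takes the value `1` at all cutoffs of `K`. -/
def IsCarried (φ : WeakDual ℂ C₀(X, ℂ)) (K : Set X) : Prop :=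
  ∀ m, IsCutoff K m → reEval φ m = 1

/-- Let `m` be a cutoff of `K` vanishing where `g ≥ c + δ`. For large `N`, `g + (N - (c + δ)) m ≤ N`
everywhere, and `φ(m) = 1` turns this into `φ(g) ≤ c + δ`. The cutoff replaces the missing
constants, and `c` may be negative. -/
theorem IsCarried.le [ProperSpace X] (hφ : φ ∈ stateSpace C₀(X, ℂ)) {K : Set X}
    (hK : IsCompact K) (h : IsCarried φ K) {g : C₀(X, ℝ)} {c : ℝ} (hg : ∀ x ∈ K, g x ≤ c) :
    reEval φ g ≤ c := by
  refine le_of_forall_pos_le_add fun δ hδ => ?_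
  obtain ⟨m, hI, h1, h0⟩ := exists_cutoff hK
    (isClosed_le (continuous_const (y := c + δ)) (map_continuous g))
    (Set.disjoint_left.2 fun x hx hx' => by
      have := hg x hx
      have : c + δ ≤ g x := hx'
      linarith)
  set N := max ‖g‖ |c + δ|
  have hN1 : ‖g‖ ≤ N := le_max_left _ _
  have hN2 : |c + δ| ≤ N := le_max_right _ _
  have hN : 0 ≤ N := (norm_nonneg g).trans hN1
  have hb := reEval_le hφ (g := g + (N - (c + δ)) • m) hN fun x => by
    have hgx : g x ≤ N := (le_abs_self _).trans ((norm_apply_le g x).trans hN1)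
    have hc := (abs_le.1 hN2)
    simp only [ZeroAtInftyContinuousMap.add_apply, ZeroAtInftyContinuousMap.smul_apply, smul_eq_mul]
    rcases le_or_gt (c + δ) (g x) with hx | hx
    · rw [h0 x hx, mul_zero, add_zero]
      exact hgx
    · have := mul_le_mul_of_nonneg_left (hI x).2 (sub_nonneg.2 hc.2)
      linarith
  rw [map_add, map_smul, h m ⟨hI, h1⟩, smul_eq_mul] at hb
  linarith

theorem IsCarried.ge [ProperSpace X] (hφ : φ ∈ stateSpace C₀(X, ℂ)) {K : Set X}
    (hK : IsCompact K) (h : IsCarried φ K) {g : C₀(X, ℝ)} {c : ℝ} (hg : ∀ x ∈ K, c ≤ g x) :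
    c ≤ reEval φ g := by
  have := h.le hφ hK (g := -g) (c := -c) fun x hx => neg_le_neg (hg x hx)
  rw [map_neg] at this
  linarith

/-- Evaluation at a point, as a state. -/
def evalState (x : X) : WeakDual ℂ C₀(X, ℂ) := StrongDual.toWeakDual (evalCLM x)

/-- A contractive positive functional has norm exactly one as soon as it takes the value `1` at some
cutoff of a compact set. -/
theorem stateSpace_of_isCarried [ProperSpace X] {K : Set X} (hK : IsCompact K)
    (hpos : ∀ a : C₀(X, ℂ), 0 ≤ φ (star a * a)) (hle : ∀ a, ‖φ a‖ ≤ ‖a‖) (h : IsCarried φ K) :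
    φ ∈ stateSpace C₀(X, ℂ) := by
  refine ⟨hpos, le_antisymm
    (ContinuousLinearMap.opNorm_le_bound _ zero_le_one fun a => by rw [one_mul]; exact hle a) ?_⟩
  obtain ⟨m, hI, h1, -⟩ := exists_cutoff hK isClosed_empty (disjoint_empty K)
  have hm := h m ⟨hI, h1⟩
  have hnorm : ‖toC m‖ ≤ 1 := by
    rw [norm_toC, norm_le_iff _ zero_le_one]
    intro x
    rw [Real.norm_of_nonneg (hI x).1]
    exact (hI x).2
  calc (1 : ℝ) = reEval φ m := hm.symm
    _ ≤ ‖φ (toC m)‖ := Complex.re_le_norm _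
    _ ≤ ‖WeakDual.toStrongDual φ‖ * ‖toC m‖ := (WeakDual.toStrongDual φ).le_opNorm _
    _ ≤ ‖WeakDual.toStrongDual φ‖ * 1 := by gcongr
    _ = _ := mul_one _

theorem isCarried_evalState {x : X} {K : Set X} (hx : x ∈ K) : IsCarried (evalState x) K :=
  fun m hm => by
    change ((m x : ℝ) : ℂ).re = 1
    rw [Complex.ofReal_re, hm.2 x hx]

theorem evalState_mem [ProperSpace X] (x : X) : evalState x ∈ stateSpace C₀(X, ℂ) :=
  stateSpace_of_isCarried isCompact_singleton (fun a => star_mul_self_nonneg (a x))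
    (fun a => norm_apply_le a x) (isCarried_evalState (mem_singleton x))

end States

/-! ### Indicator projections of the classical topography -/

section Indicator

variable {X : Type u} [MetricSpace X] [ProperSpace X] {K : Set (classicalTriple X).Spec}

/-- A real function, as an element of the topography. -/
def topC (m : C₀(X, ℝ)) : (classicalTriple X).M := ⟨toC m, trivial⟩

theorem mem_cutoffs_iff {m : (classicalTriple X).M} :
    m ∈ (classicalTriple X).cutoffs K ↔ ∃ g, IsCutoff (evalChar ⁻¹' K) g ∧ topC g = m := by
  constructor
  · intro h
    obtain ⟨g, hg, hgm⟩ := exists_isCutoff_toC_eq (K := evalChar ⁻¹' K) (f := m.1)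
      (fun x => (h (evalChar x)).1) fun x hx => (h (evalChar x)).2 hx
    exact ⟨g, hg, Subtype.ext hgm⟩
  · rintro ⟨g, hg, rfl⟩ χ
    obtain ⟨x, rfl⟩ := evalChar_surjective χ
    refine ⟨⟨g x, hg.1 x, rfl⟩, fun hx => ?_⟩
    change ((g x : ℝ) : ℂ) = 1
    rw [hg.2 x hx, Complex.ofReal_one]

theorem exists_isCutoff {K : Set X} (hK : IsCompact K) : ∃ m, IsCutoff K m := by
  obtain ⟨m, hI, h1, -⟩ := exists_cutoff hK isClosed_empty (disjoint_empty K)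
  exact ⟨m, hI, h1⟩

/-- The infimum of principal filters is directed because the product of two cutoffs is a cutoff
below both. -/
theorem hasBasis_indicatorFilter (hK : IsCompact K) :
    ((classicalTriple X).indicatorFilter K).HasBasis (IsCutoff (evalChar ⁻¹' K))
      fun g => {m | ∃ h, IsCutoff (evalChar ⁻¹' K) h ∧ (∀ x, h x ≤ g x) ∧ topC h = m} := by
  have hset : ∀ g : C₀(X, ℝ), {m | m ∈ (classicalTriple X).cutoffs K ∧
      ∀ χ : (classicalTriple X).Spec, (χ m).re ≤ (χ (topC g)).re} =
      {m | ∃ h, IsCutoff (evalChar ⁻¹' K) h ∧ (∀ x, h x ≤ g x) ∧ topC h = m} := by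
    intro g
    ext m
    constructor
    · rintro ⟨hm, hle⟩
      obtain ⟨h, hh, rfl⟩ := mem_cutoffs_iff.1 hm
      exact ⟨h, hh, fun x => hle (evalChar x), rfl⟩
    · rintro ⟨h, hh, hle, rfl⟩
      refine ⟨mem_cutoffs_iff.2 ⟨h, hh, rfl⟩, fun χ => ?_⟩
      obtain ⟨x, rfl⟩ := evalChar_surjective χ
      exact hle x
  have hfil : (classicalTriple X).indicatorFilter K = ⨅ g ∈ {g | IsCutoff (evalChar ⁻¹' K) g},
      𝓟 {m | ∃ h, IsCutoff (evalChar ⁻¹' K) h ∧ (∀ x, h x ≤ g x) ∧ topC h = m} := by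
    have himg : (classicalTriple X).cutoffs K = topC '' {g | IsCutoff (evalChar ⁻¹' K) g} := by
      ext m
      rw [mem_cutoffs_iff]
      rfl
    simp_rw [← hset]
    rw [LipTriple.indicatorFilter]
    conv_lhs => rw [himg]
    rw [iInf_image, ← himg]
  rw [hfil]
  refine hasBasis_biInf_principal ?_ (exists_isCutoff (isCompact_preimage_evalChar hK))
  rintro f hf g hg
  refine ⟨f * g, ⟨fun x => ⟨mul_nonneg (hf.1 x).1 (hg.1 x).1,
    mul_le_one₀ (hf.1 x).2 (hg.1 x).1 (hg.1 x).2⟩, fun x hx => ?_⟩, ?_, ?_⟩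
  · rw [ZeroAtInftyContinuousMap.mul_apply, hf.2 x hx, hg.2 x hx, mul_one]
  · rintro m ⟨h, hh, hle, rfl⟩
    exact ⟨h, hh, fun x => (hle x).trans (mul_le_of_le_one_right (hf.1 x).1 (hg.1 x).2), rfl⟩
  · rintro m ⟨h, hh, hle, rfl⟩
    exact ⟨h, hh, fun x => (hle x).trans (mul_le_of_le_one_left (hg.1 x).1 (hf.1 x).2), rfl⟩

theorem neBot_indicatorFilter (hK : IsCompact K) :
    ((classicalTriple X).indicatorFilter K).NeBot :=
  (hasBasis_indicatorFilter hK).neBot_iff.2 fun {g} hg => ⟨topC g, g, hg, fun _ => le_rfl, rfl⟩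

theorem limUnder_indicatorFilter_of_eq (hK : IsCompact K) {G : (classicalTriple X).M → ℂ} {c : ℂ}
    {g : C₀(X, ℝ)} (hg : IsCutoff (evalChar ⁻¹' K) g)
    (h : ∀ m, IsCutoff (evalChar ⁻¹' K) m → (∀ x, m x ≤ g x) → G (topC m) = c) :
    limUnder ((classicalTriple X).indicatorFilter K) G = c := by
  have := neBot_indicatorFilter hK
  refine (tendsto_const_nhds.congr' ?_).limUnder_eq
  refine (hasBasis_indicatorFilter hK).eventually_iff.2 ⟨g, hg, ?_⟩
  rintro _ ⟨m, hm, hle, rfl⟩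
  exact (h m hm hle).symm

/-- Along the decreasing net of cutoffs, a monotone non-negative functional converges to its infimum
over all cutoffs. -/
theorem limUnder_indicatorFilter_of_monotone (hK : IsCompact K) {G : (classicalTriple X).M → ℂ}
    (H : C₀(X, ℝ) → ℝ) (hGH : ∀ m, G (topC m) = H m)
    (h0 : ∀ m, IsCutoff (evalChar ⁻¹' K) m → 0 ≤ H m)
    (hmono : ∀ m n, IsCutoff (evalChar ⁻¹' K) m → IsCutoff (evalChar ⁻¹' K) n →
      (∀ x, m x ≤ n x) → H m ≤ H n) :
    ∃ c : ℝ, limUnder ((classicalTriple X).indicatorFilter K) G = c ∧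
      ∀ m, IsCutoff (evalChar ⁻¹' K) m → c ≤ H m := by
  have := neBot_indicatorFilter hK
  set s : Set ℝ := H '' {m | IsCutoff (evalChar ⁻¹' K) m}
  have hs : s.Nonempty := (exists_isCutoff (isCompact_preimage_evalChar hK)).imp' H
    fun m hm => mem_image_of_mem _ hm
  have hb : BddBelow s := ⟨0, by rintro _ ⟨m, hm, rfl⟩; exact h0 m hm⟩
  have hle : ∀ m, IsCutoff (evalChar ⁻¹' K) m → sInf s ≤ H m := fun m hm =>
    csInf_le hb (mem_image_of_mem _ hm)
  refine ⟨sInf s, Tendsto.limUnder_eq (Metric.tendsto_nhds.2 fun ε hε => ?_), hle⟩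
  obtain ⟨_, ⟨n, hn, rfl⟩, hlt⟩ := exists_lt_of_csInf_lt hs (lt_add_of_pos_right (sInf s) hε)
  refine (hasBasis_indicatorFilter hK).eventually_iff.2 ⟨n, hn, ?_⟩
  rintro _ ⟨m, hm, hmn, rfl⟩
  have h1 := hle m hm
  have h2 := hmono m n hm hn hmn
  rw [hGH, Complex.dist_of_im_eq (by simp), Complex.ofReal_re, Complex.ofReal_re, Real.dist_eq,
    abs_lt]
  constructor <;> linarith

/-- `φ(1_K)` is the infimum of `φ(m)` over cutoffs, each at most `1`; it equals `1` only if every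
`φ(m)` does. -/
theorem mem_statesOn_iff (hK : IsCompact K) {φ : WeakDual ℂ C₀(X, ℂ)} :
    φ ∈ (classicalTriple X).statesOn K ↔
      φ ∈ stateSpace C₀(X, ℂ) ∧ IsCarried φ (evalChar ⁻¹' K) := by
  refine and_congr_right fun hφ => ⟨fun h => ?_, fun h => ?_⟩
  · obtain ⟨c, hc, hle⟩ := limUnder_indicatorFilter_of_monotone hK
      (G := fun m => φ m.1) (reEval φ) (fun m => apply_toC hφ m)
      (fun m hm => reEval_nonneg hφ fun x => (hm.1 x).1) (fun m n _ _ h => reEval_mono hφ h)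
    have hc1 : (c : ℂ) = 1 := hc.symm.trans h
    rw [Complex.ofReal_eq_one] at hc1
    intro m hm
    exact le_antisymm (reEval_le hφ zero_le_one fun x => (hm.1 x).2) (hc1 ▸ hle m hm)
  · obtain ⟨m, hm⟩ := exists_isCutoff (isCompact_preimage_evalChar hK)
    refine limUnder_indicatorFilter_of_eq hK hm fun n hn _ => ?_
    exact (apply_toC hφ n).trans (by rw [h n hn, Complex.ofReal_one])

/-- Evaluation at a point `x` outside `K` is a state whose corner vanishes, because some cutoff is
`0` at `x`. Conversely, if `a` vanishes off `K` then `m a m = a` for every cutoff `m`. -/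
theorem mem_localSa_iff (hK : IsCompact K) {a : C₀(X, ℂ)} :
    a ∈ (classicalTriple X).localSa K ↔
      IsSelfAdjoint a ∧ ∀ x, evalChar x ∉ K → a x = 0 := by
  refine and_congr_right fun ha => ⟨fun h x hx => ?_, fun h φ hφ => ?_⟩
  · obtain ⟨m, hI, h1, h0⟩ := exists_cutoff (isCompact_preimage_evalChar hK)
      (isClosed_singleton (x := x)) (Set.disjoint_singleton_right.2 hx)
    have hl := h (evalState x) (evalState_mem x)
    refine hl.symm.trans (limUnder_indicatorFilter_of_eq hK ⟨hI, h1⟩ fun n hn hle => ?_)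
    have hnx : n x = 0 := le_antisymm ((hle x).trans (h0 x rfl).le) (hn.1 x).1
    change ((n x : ℝ) : ℂ) * a x * ((n x : ℝ) : ℂ) = 0
    rw [hnx, Complex.ofReal_zero, mul_zero]
  · obtain ⟨m, hm⟩ := exists_isCutoff (isCompact_preimage_evalChar hK)
    refine limUnder_indicatorFilter_of_eq hK hm fun n hn _ => ?_
    have e : toC n * a * toC n = a := ?_
    · exact congrArg φ e
    ext x
    simp only [ZeroAtInftyContinuousMap.mul_apply, toC_apply]
    by_cases hx : evalChar x ∈ K
    · rw [hn.2 x hx, Complex.ofReal_one, mul_one, one_mul]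
    · rw [h x hx, mul_zero, zero_mul]

theorem mem_loc_iff (hK : IsCompact K) {a : C₀(X, ℂ)} :
    a ∈ (classicalTriple X).loc K ↔
      lipSeminorm X a < ∞ ∧ ∀ x, evalChar x ∉ K → a x = 0 := by
  refine (and_congr_left' (mem_localSa_iff hK)).trans
    ⟨fun h => ⟨h.2, h.1.2⟩, fun h => ⟨⟨?_, h.2⟩, h.1⟩⟩
  obtain ⟨l, -, hl, -⟩ := lipSeminorm_lt_top h.1
  exact hl

end Indicator

/-! ### Tame sets of states and the Monge-Kantorovich metric -/

section Metrizes

variable {X : Type u} [MetricSpace X]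

theorem enorm_sub_le_mkDist {φ ψ : WeakDual ℂ C₀(X, ℂ)} {k : C₀(X, ℝ)} {l : ℝ≥0} (hl : l ≠ 0)
    (hk : LipschitzWith l k) :
    ‖φ (toC k) - ψ (toC k)‖ₑ ≤ l * (classicalTriple X).mkDist φ ψ := by
  have h1 : lipSeminorm X (toC ((l : ℝ)⁻¹ • k)) ≤ 1 := by
    rw [toC_smul, lipSeminorm_smul, abs_of_nonneg (by positivity), ← NNReal.coe_inv,
      ENNReal.ofReal_coe_nnreal]
    calc _ ≤ ((l⁻¹ : ℝ≥0) : ℝ≥0∞) * l := by gcongr; exact (lipSeminorm_toC_le_iff k l).2 hk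
      _ = 1 := by rw [← ENNReal.coe_mul, inv_mul_cancel₀ hl, ENNReal.coe_one]
  have h2 : ‖φ (toC ((l : ℝ)⁻¹ • k)) - ψ (toC ((l : ℝ)⁻¹ • k))‖ₑ ≤
      (classicalTriple X).mkDist φ ψ :=
    le_iSup₂ (f := fun (a : C₀(X, ℂ)) (_ : IsSelfAdjoint a ∧ lipSeminorm X a ≤ 1) =>
      ‖φ a - ψ a‖ₑ) _ ⟨isSelfAdjoint_toC _, h1⟩
  have e : φ (toC k) - ψ (toC k) =
      ((l : ℝ) : ℂ) • (φ (toC ((l : ℝ)⁻¹ • k)) - ψ (toC ((l : ℝ)⁻¹ • k))) := by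
    rw [toC_smul, map_smul, map_smul, ← smul_sub, smul_smul, ← Complex.ofReal_mul,
      mul_inv_cancel₀ (by exact_mod_cast hl), Complex.ofReal_one, one_smul]
  rw [e, enorm_smul]
  have e2 : ‖((l : ℝ) : ℂ)‖ₑ = l := by
    rw [← ofReal_norm, Complex.norm_real, Real.norm_of_nonneg l.coe_nonneg,
      ENNReal.ofReal_coe_nnreal]
  rw [e2]
  gcongr

theorem mkDist_le_of {φ ψ : WeakDual ℂ C₀(X, ℂ)} (hφ : φ ∈ stateSpace C₀(X, ℂ))
    (hψ : ψ ∈ stateSpace C₀(X, ℂ)) {c : ℝ}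
    (h : ∀ a : C₀(X, ℝ), LipschitzWith 1 a → |reEval φ a - reEval ψ a| ≤ c) :
    (classicalTriple X).mkDist φ ψ ≤ ENNReal.ofReal c := by
  refine iSup₂_le fun a ha => ?_
  change C₀(X, ℂ) at a
  obtain ⟨ha1, ha2⟩ := (lipSeminorm_le_iff a 1).1 ha.2
  rw [← toC_reC ha1] at ha2 ⊢
  have h1 := h _ ((lipschitzWith_toC_iff _ _).1 ha2)
  have e : ‖φ (toC (reC a)) - ψ (toC (reC a))‖ₑ ≤ ENNReal.ofReal c := by
    rw [apply_toC hφ, apply_toC hψ, ← Complex.ofReal_sub, ← ofReal_norm, Complex.norm_real]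
    exact ENNReal.ofReal_le_ofReal h1
  exact e

/-- Arzelà-Ascoli modulo constants: normalised by their value at `x`, the 1-Lipschitz functions have
bounded restrictions to a finite `ε/3`-net of `K`, hence a totally bounded set of them. Two moves to
the net and one comparison on it cost `ε/3` each. -/
theorem exists_finite_lipschitz_net {K : Set X} (hK : IsCompact K) {ε : ℝ} (hε : 0 < ε) :
    ∃ T : Set C₀(X, ℝ), T.Finite ∧ ∀ a : C₀(X, ℝ), LipschitzWith 1 a →
      ∃ b ∈ T, ∃ c : ℝ, ∀ p ∈ K, |a p - b p - c| ≤ ε := by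
  rcases K.eq_empty_or_nonempty with rfl | ⟨x, hx⟩
  · exact ⟨{0}, finite_singleton _, fun a _ => ⟨0, rfl, 0, fun p hp => hp.elim⟩⟩
  obtain ⟨t, htK, htf, hcov⟩ := hK.finite_cover_balls (show 0 < ε / 3 by positivity)
  have := htf.fintype
  set F : Set C₀(X, ℝ) := {a | LipschitzWith 1 a}
  let Φ : C₀(X, ℝ) → t → ℝ := fun a p => a p - a x
  obtain ⟨R, hR⟩ := htf.isBounded.subset_closedBall x
  have htb : TotallyBounded (Φ '' F) := by
    refine (isCompact_closedBall (0 : t → ℝ) |R|).totallyBounded.subset ?_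
    rintro _ ⟨a, ha, rfl⟩
    rw [mem_closedBall_zero_iff, pi_norm_le_iff_of_nonneg (abs_nonneg R)]
    intro p
    have h1 := LipschitzWith.dist_le_mul ha p x
    rw [NNReal.coe_one, one_mul, Real.dist_eq] at h1
    exact h1.trans ((hR p.2 : dist (p : X) x ≤ R).trans (le_abs_self R))
  obtain ⟨s, hsF, hsf, hs⟩ := Metric.finite_approx_of_totallyBounded htb (ε / 3) (by positivity)
  obtain ⟨T, hTF, hTf, rfl⟩ := exists_subset_image_finite_and.1 ⟨s, hsF, hsf, rfl⟩
  refine ⟨T, hTf, fun a ha => ?_⟩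
  obtain ⟨_, ⟨b, hb, rfl⟩, hab⟩ := mem_iUnion₂.1 (hs (mem_image_of_mem Φ ha))
  refine ⟨b, hb, a x - b x, fun p hp => ?_⟩
  obtain ⟨q, hq, hpq⟩ := mem_iUnion₂.1 (hcov hp)
  have h1 := LipschitzWith.dist_le_mul ha p q
  have h2 := LipschitzWith.dist_le_mul (hTF hb) p q
  have h3 := (dist_le_pi_dist (Φ a) (Φ b) ⟨q, hq⟩).trans (Metric.mem_ball.1 hab).le
  rw [NNReal.coe_one, one_mul, Real.dist_eq, abs_le] at h1 h2
  rw [Real.dist_eq, abs_le] at h3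
  have h4 : dist p q < ε / 3 := hpq
  simp only [Φ] at h3
  rw [abs_le]
  constructor <;> linarith

/-- Metric convergence implies weak* convergence without tameness: states are contractive and
Lipschitz functions are dense among the real ones. -/
theorem iInf_mkDist_le_nhds {S : Set (WeakDual ℂ C₀(X, ℂ))}
    (hS : S ⊆ stateSpace C₀(X, ℂ)) {φ : WeakDual ℂ C₀(X, ℂ)} (hφ : φ ∈ S) :
    ⨅ (ε : ℝ) (_ : 0 < ε),
      𝓟 {ψ | ψ ∈ S ∧ (classicalTriple X).mkDist φ ψ < ENNReal.ofReal ε} ≤ 𝓝 φ := by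
  set F := ⨅ (ε : ℝ) (_ : 0 < ε),
    𝓟 {ψ | ψ ∈ S ∧ (classicalTriple X).mkDist φ ψ < ENNReal.ofReal ε}
  have hF : ∀ ε : ℝ, 0 < ε →
      ∀ᶠ ψ in F, ψ ∈ S ∧ (classicalTriple X).mkDist φ ψ < ENNReal.ofReal ε := fun ε hε =>
    mem_iInf_of_mem ε (mem_iInf_of_mem hε (mem_principal_self _))
  have hreal : ∀ g : C₀(X, ℝ), Tendsto (fun ψ : WeakDual ℂ C₀(X, ℂ) => ψ (toC g)) F
      (𝓝 (φ (toC g))) := fun g => by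
    refine Metric.tendsto_nhds.2 fun ε hε => ?_
    obtain ⟨k, ⟨⟨l, hl⟩, -⟩, hgk⟩ := exists_lipCompact_approx g (show 0 < ε / 4 by positivity)
    -- The constant is raised to be non-zero, so that `k` can be rescaled to seminorm at most one.
    have hl' : LipschitzWith (l + 1) k := hl.weaken le_self_add
    have hl0 : (0 : ℝ) < ((l + 1 : ℝ≥0) : ℝ) := by positivity
    filter_upwards [hF (ε / 4 / (l + 1 : ℝ≥0)) (by positivity)] with ψ hψ
    have h1 : ‖φ (toC k) - ψ (toC k)‖ₑ ≤ ENNReal.ofReal (ε / 4) := by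
      refine (enorm_sub_le_mkDist (by positivity) hl').trans ?_
      calc ((l + 1 : ℝ≥0) : ℝ≥0∞) * (classicalTriple X).mkDist φ ψ
          ≤ ENNReal.ofReal ((l + 1 : ℝ≥0) : ℝ) * ENNReal.ofReal (ε / 4 / (l + 1 : ℝ≥0)) := by
            rw [ENNReal.ofReal_coe_nnreal]
            gcongr
            exact hψ.2.le
        _ = ENNReal.ofReal (ε / 4) := by
            rw [← ENNReal.ofReal_mul hl0.le, mul_div_cancel₀ _ hl0.ne']
    rw [← ofReal_norm, ENNReal.ofReal_le_ofReal_iff (by positivity)] at h1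
    have h2 : ∀ χ ∈ S, ‖χ (toC g) - χ (toC k)‖ ≤ ε / 4 := fun χ hχ => by
      rw [← map_sub, ← toC_sub]
      exact (norm_state_apply_le (hS hχ) _).trans (by rwa [norm_toC])
    rw [dist_eq_norm]
    have e : ψ (toC g) - φ (toC g) = (ψ (toC g) - ψ (toC k)) - (φ (toC k) - ψ (toC k)) -
      (φ (toC g) - φ (toC k)) := by ring
    rw [e]
    have h3 := norm_sub_le ((ψ (toC g) - ψ (toC k)) - (φ (toC k) - ψ (toC k)))
      (φ (toC g) - φ (toC k))
    have h4 := norm_sub_le (ψ (toC g) - ψ (toC k)) (φ (toC k) - ψ (toC k))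
    have h5 := h2 φ hφ
    have h6 := h2 ψ hψ.1
    linarith
  have hid : Tendsto id F (𝓝 φ) := by
    refine tendsto_iff_forall_eval_tendsto_topDualPairing.2 fun f => ?_
    have h := (hreal (reC f)).add ((hreal (imC f)).const_mul Complex.I)
    have e : ∀ ψ : WeakDual ℂ C₀(X, ℂ), ψ f = ψ (toC (reC f)) + Complex.I * ψ (toC (imC f)) :=
      fun ψ => by rw [← smul_eq_mul, ← map_smul, ← map_add, toC_reC_add_imC]
    rw [← e φ] at h
    exact h.congr fun ψ => (e ψ).symm
  exact hid

variable [ProperSpace X]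

/-- Nearly all the mass of `φ` sits in a ball of radius `R`, where a tent of height `N` is at least
`N - R`; for large `N` the loss `R` is a small fraction of `N`. -/
theorem exists_tent_ge {φ : WeakDual ℂ C₀(X, ℂ)} (hφ : φ ∈ stateSpace C₀(X, ℂ)) (x : X) {δ : ℝ}
    (hδ : 0 < δ) : ∃ N₀ : ℝ, ∀ N ≥ N₀, N * (1 - δ) ≤ reEval φ (tent N x) := by
  obtain ⟨g, hg1, hg⟩ := exists_reEval_gt hφ (half_pos hδ)
  obtain ⟨R, hR⟩ := (isCompact_le_norm g (half_pos hδ)).isBounded.subset_closedBall x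
  refine ⟨max 1 (2 * R / δ), fun N hN => ?_⟩
  have hN1 : 1 ≤ N := (le_max_left _ _).trans hN
  have hN2 : R ≤ N * (δ / 2) := by
    have := (le_max_right _ _).trans hN
    rw [div_le_iff₀ hδ] at this
    linarith
  have h := reEval_le hφ (g := N • g - tent N x) (c := N * (δ / 2)) (by positivity) fun p => by
    simp only [ZeroAtInftyContinuousMap.sub_apply, ZeroAtInftyContinuousMap.smul_apply,
      smul_eq_mul, tent_apply]
    by_cases hp : δ / 2 ≤ ‖g p‖
    · have h1 : dist p x ≤ R := hR hp
      have h2 := mul_le_mul_of_nonneg_left (hg1 p) (zero_le_one.trans hN1)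
      have h3 := le_max_right 0 (N - dist p x)
      linarith
    · have h1 := (le_abs_self (g p)).trans (not_le.1 hp).le
      have h2 := mul_le_mul_of_nonneg_left h1 (zero_le_one.trans hN1)
      have h3 := le_max_left 0 (N - dist p x)
      linarith
  rw [map_sub, map_smul, smul_eq_mul] at h
  have h2 := mul_le_mul_of_nonneg_left hg.le (zero_le_one.trans hN1)
  linarith

/-- Take `K` with the tameness supremum at most `1`. Tents of every height `N` are 1-Lipschitz, and
compressing one by a cutoff `m` leaves at most `N φ(m)`; hence `N (1 - δ/2) - 1 ≤ N φ(m)`. Letting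
`N` grow leaves no mass off `K`. -/
theorem exists_carrier_of_isTame [Nonempty X] {S : Set (WeakDual ℂ C₀(X, ℂ))}
    (hS : S ⊆ stateSpace C₀(X, ℂ)) (hT : (classicalTriple X).IsTame S) :
    ∃ K : Set X, IsCompact K ∧ ∀ φ ∈ S, IsCarried φ K := by
  obtain ⟨x⟩ := ‹Nonempty X›
  obtain ⟨K, hK⟩ := (hT.eventually (ge_mem_nhds one_pos)).exists
  refine ⟨evalChar ⁻¹' (K : Set (classicalTriple X).Spec),
    isCompact_preimage_evalChar K.isCompact, fun φ hφS m hm => ?_⟩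
  have hφ := hS hφS
  refine le_antisymm (reEval_le hφ zero_le_one fun p => (hm.1 p).2)
    (le_of_forall_pos_le_add fun δ hδ => ?_)
  obtain ⟨N₀, hN₀⟩ := exists_tent_ge hφ x (half_pos hδ)
  set N := max N₀ (2 / δ) with hN
  have hNδ : 1 ≤ N * (δ / 2) := by
    have := le_max_right N₀ (2 / δ)
    rw [← hN, div_le_iff₀ hδ] at this
    linarith
  have hNpos : 0 < N := lt_of_lt_of_le (by positivity) (le_max_right N₀ (2 / δ))
  have h1 := hN₀ N (le_max_left _ _)
  have ht0 : ∀ p, 0 ≤ tent N x p := fun p => le_max_left _ _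
  obtain ⟨c, hc, hle⟩ := limUnder_indicatorFilter_of_monotone K.isCompact
    (G := fun k => (fun f : C₀(X, ℂ) => φ (f * toC (tent N x) * f)) k.1)
    (fun k => reEval φ (k * tent N x * k))
    (fun k => by
      rw [← apply_toC hφ, toC_mul, toC_mul]
      rfl)
    (fun k hk => reEval_nonneg hφ fun p =>
      mul_nonneg (mul_nonneg (hk.1 p).1 (ht0 p)) (hk.1 p).1)
    (fun k n hk hn hkn => reEval_mono hφ fun p =>
      mul_le_mul (mul_le_mul_of_nonneg_right (hkn p) (ht0 p)) (hkn p) (hk.1 p).1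
        (mul_nonneg (hn.1 p).1 (ht0 p)))
  have h2 : c ≤ N * reEval φ m := by
    refine (hle m hm).trans ?_
    rw [show N * reEval φ m = reEval φ (N • m) by rw [map_smul, smul_eq_mul]]
    refine reEval_mono hφ fun p => ?_
    simp only [ZeroAtInftyContinuousMap.mul_apply, ZeroAtInftyContinuousMap.smul_apply,
      smul_eq_mul]
    have h3 : tent N x p ≤ N := max_le hNpos.le (sub_le_self _ dist_nonneg)
    calc m p * tent N x p * m p ≤ 1 * N * m p := by
          gcongr
          · exact (hm.1 p).1
          · exact ht0 p
          · exact (hm.1 p).2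
      _ = N * m p := by ring
  have h3 : ‖φ (toC (tent N x)) - (classicalTriple X).evalCorner φ K (toC (tent N x))‖ₑ ≤ 1 :=
    le_trans (le_iSup₂_of_le φ hφS (le_iSup₂ (f := fun (a : C₀(X, ℂ))
      (_ : IsSelfAdjoint a ∧ lipSeminorm X a ≤ 1) =>
      ‖φ a - (classicalTriple X).evalCorner φ K a‖ₑ) (toC (tent N x))
      ⟨isSelfAdjoint_toC _, (lipSeminorm_toC_le_iff _ 1).2 (lipschitzWith_tent N x)⟩)) hK
  have h4 : (classicalTriple X).evalCorner φ K (toC (tent N x)) = c := hc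
  rw [h4, apply_toC hφ, ← Complex.ofReal_sub, ← ofReal_norm, Complex.norm_real,
    ENNReal.ofReal_le_one] at h3
  have h5 := (abs_le.1 h3).2
  have h6 : N * 1 ≤ N * (reEval φ m + δ) := by linarith
  exact le_of_mul_le_mul_left h6 hNpos

/-- Only the finitely many net elements `b` need weak* control. As `a - b` is within `ε/4` of a
constant `c` on `K`, states carried by `K` send it within `ε/4` of the same `c`; the total is
`3ε/4`. -/
theorem setOf_mkDist_lt_mem_nhds {S : Set (WeakDual ℂ C₀(X, ℂ))}
    (hS : S ⊆ stateSpace C₀(X, ℂ)) {K : Set X} (hK : IsCompact K)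
    (hSK : ∀ φ ∈ S, IsCarried φ K) {φ : WeakDual ℂ C₀(X, ℂ)} (hφ : φ ∈ S) {ε : ℝ} (hε : 0 < ε) :
    {ψ | ψ ∈ S ∧ (classicalTriple X).mkDist φ ψ < ENNReal.ofReal ε} ∈ 𝓝[S] φ := by
  obtain ⟨T, hTf, hT⟩ := exists_finite_lipschitz_net hK (show 0 < ε / 4 by positivity)
  have hnhd : ∀ᶠ ψ in 𝓝[S] φ, ∀ b ∈ T, |reEval φ b - reEval ψ b| < ε / 4 := by
    refine (hTf.eventually_all).2 fun b _ => ?_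
    have hc : Continuous fun ψ : WeakDual ℂ C₀(X, ℂ) => |reEval φ b - reEval ψ b| :=
      (continuous_const.sub (Complex.continuous_re.comp (WeakDual.eval_continuous (toC b)))).abs
    refine nhdsWithin_le_nhds ((isOpen_lt hc continuous_const).mem_nhds ?_)
    simpa using hε
  filter_upwards [hnhd, self_mem_nhdsWithin] with ψ hψ hψS
  refine ⟨hψS, (mkDist_le_of (hS hφ) (hS hψS) (c := 3 / 4 * ε) fun a ha => ?_).trans_lt
    ((ENNReal.ofReal_lt_ofReal_iff hε).2 (by linarith))⟩
  obtain ⟨b, hb, c, hc⟩ := hT a ha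
  have h1 := abs_lt.1 (hψ b hb)
  have hu : ∀ p ∈ K, (a - b) p ≤ c + ε / 4 := fun p hp => by
    have := (abs_le.1 (hc p hp)).2
    rw [ZeroAtInftyContinuousMap.sub_apply]
    linarith
  have hl : ∀ p ∈ K, c - ε / 4 ≤ (a - b) p := fun p hp => by
    have := (abs_le.1 (hc p hp)).1
    rw [ZeroAtInftyContinuousMap.sub_apply]
    linarith
  have h2 := (hSK φ hφ).le (hS hφ) hK hu
  have h3 := (hSK φ hφ).ge (hS hφ) hK hl
  have h4 := (hSK ψ hψS).le (hS hψS) hK hu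
  have h5 := (hSK ψ hψS).ge (hS hψS) hK hl
  rw [map_sub] at h2 h3 h4 h5
  rw [abs_le]
  constructor <;> linarith

theorem isQuantumLocallyCompact_metrizes [Nonempty X] {S : Set (WeakDual ℂ C₀(X, ℂ))}
    (hS : S ⊆ stateSpace C₀(X, ℂ)) (hT : (classicalTriple X).IsTame S)
    {φ : WeakDual ℂ C₀(X, ℂ)} (hφ : φ ∈ S) :
    𝓝[S] φ = ⨅ (ε : ℝ) (_ : 0 < ε),
      𝓟 {ψ | ψ ∈ S ∧ (classicalTriple X).mkDist φ ψ < ENNReal.ofReal ε} := by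
  obtain ⟨K, hK, hSK⟩ := exists_carrier_of_isTame hS hT
  refine le_antisymm (le_iInf₂ fun ε hε => le_principal_iff.2
    (setOf_mkDist_lt_mem_nhds hS hK hSK hφ hε)) (le_inf (iInf_mkDist_le_nhds hS hφ) ?_)
  exact iInf₂_le_of_le 1 one_pos (principal_mono.2 fun ψ hψ => hψ.1)

end Metrizes

/-! ### Classical proper quantum metric spaces -/

section Classical

variable {X : Type u} [MetricSpace X]

theorem isLipschitzPair_classical [ProperSpace X] : (classicalTriple X).IsLipschitzPair where
  isSelfAdjoint a ha := by
    obtain ⟨l, -, h, -⟩ := lipSeminorm_lt_top ha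
    exact h
  add_le := lipSeminorm_add_le
  smul := lipSeminorm_smul
  dense a ha := by
    refine closure_mono ?_ (mem_closure_lipCompact ha)
    rintro _ ⟨g, ⟨⟨l, hl⟩, -⟩, rfl⟩
    exact ((lipSeminorm_toC_le_iff g l).2 hl).trans_lt ENNReal.coe_lt_top
  eq_zero_iff := lipSeminorm_eq_zero_iff

theorem exists_isApproximateUnit (A : Type u) [NonUnitalCStarAlgebra A] :
    ∃ l : Filter A, l.IsApproximateUnit := by
  let _ := CStarAlgebra.spectralOrder A
  have := CStarAlgebra.spectralOrderedRing A
  exact ⟨_, (CStarAlgebra.increasingApproximateUnit A).toIsApproximateUnit⟩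

theorem isTopographic_classical : (classicalTriple X).IsTopographic where
  isClosed := isClosed_univ
  comm a _ b _ := mul_comm (show C₀(X, ℂ) from a) b
  approxUnit := by
    obtain ⟨l, hl⟩ := exists_isApproximateUnit C₀(X, ℂ)
    exact ⟨l, hl, univ_mem⟩

theorem isQuantumLocallyCompact_classical [ProperSpace X] [Nonempty X] :
    (classicalTriple X).IsQuantumLocallyCompact where
  lipschitzPair := isLipschitzPair_classical
  topographic := isTopographic_classical
  metrizes _ hS hT _ hφ := isQuantumLocallyCompact_metrizes hS hT hφ

theorem leibnizOn_classical {S : Set C₀(X, ℂ)} : (classicalTriple X).LeibnizOn S := by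
  intro a _ b _
  change C₀(X, ℂ) at a b
  have h1 : jordan a b = a * b := by
    rw [jordan, mul_comm b a, ← two_smul ℂ, smul_smul, inv_mul_cancel₀ two_ne_zero, one_smul]
  have h2 : lie a b = 0 := by rw [lie, mul_comm b a, sub_self, smul_zero]
  refine ⟨?_, ?_⟩
  · refine le_trans (le_of_eq ?_) (lipSeminorm_mul_le (f := a) (g := b))
    exact congrArg (lipSeminorm X) h1
  · refine le_trans (le_of_eq ?_) bot_le
    exact (congrArg (lipSeminorm X) h2).trans lipSeminorm_zero

variable [ProperSpace X]

theorem lipCompact_image_subset_locStar : toC '' lipCompact X ⊆ (classicalTriple X).locStar := by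
  rintro _ ⟨g, ⟨⟨l, hl⟩, K, hK, hg⟩, rfl⟩
  have hK' := hK.image (continuous_evalChar (X := X))
  refine ⟨_, hK', (mem_loc_iff hK').2
    ⟨((lipSeminorm_toC_le_iff g l).2 hl).trans_lt ENNReal.coe_lt_top, fun x hx => ?_⟩⟩
  rw [toC_apply, hg x fun h => hx (mem_image_of_mem _ h), Complex.ofReal_zero]

/-- Restriction to `K` is isometric on these functions, and `C(K, ℂ)` is second countable. -/
theorem isSeparable_supported (K : Set X) (hK : IsCompact K) :
    TopologicalSpace.IsSeparable {f : C₀(X, ℂ) | ∀ x ∉ K, f x = 0} := by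
  have := isCompact_iff_compactSpace.1 hK
  let Φ : {f : C₀(X, ℂ) | ∀ x ∉ K, f x = 0} → C(K, ℂ) := fun f =>
    ⟨fun x => f.1 x, (map_continuous f.1).comp continuous_subtype_val⟩
  have hΦ : Isometry Φ := by
    refine Isometry.of_dist_eq fun f g => ?_
    rw [Subtype.dist_eq, dist_eq_norm, dist_eq_norm]
    refine le_antisymm ((ContinuousMap.norm_le _ (norm_nonneg _)).2 fun x =>
      norm_apply_le (f.1 - g.1) x) ((norm_le_iff _ (norm_nonneg _)).2 fun x => ?_)
    by_cases hx : x ∈ K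
    · exact ContinuousMap.norm_coe_le_norm (Φ f - Φ g) ⟨x, hx⟩
    · rw [ZeroAtInftyContinuousMap.sub_apply, f.2 x hx, g.2 x hx, sub_zero, norm_zero]
      exact norm_nonneg _
  have := hΦ.isEmbedding.secondCountableTopology
  exact TopologicalSpace.IsSeparable.of_subtype _

theorem separableSpace_zeroAtInfty [Nonempty X] : TopologicalSpace.SeparableSpace C₀(X, ℂ) := by
  obtain ⟨x⟩ := ‹Nonempty X›
  have h1 : TopologicalSpace.IsSeparable (toC '' lipCompact X) := by
    refine (TopologicalSpace.IsSeparable.iUnion fun n : ℕ =>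
      isSeparable_supported _ (isCompact_closedBall x n)).mono ?_
    rintro _ ⟨g, ⟨-, K, hK, hg⟩, rfl⟩
    obtain ⟨R, hR⟩ := hK.isBounded.subset_closedBall x
    obtain ⟨n, hn⟩ := exists_nat_ge R
    refine mem_iUnion.2 ⟨n, fun p hp => ?_⟩
    rw [toC_apply, hg p fun h => hp (Metric.closedBall_subset_closedBall hn (hR h)),
      Complex.ofReal_zero]
  have h2 := h1.closure
  have h3 : TopologicalSpace.IsSeparable (univ : Set C₀(X, ℂ)) := by
    refine ((h2.prod h2).image (f := fun p : C₀(X, ℂ) × C₀(X, ℂ) => p.1 + Complex.I • p.2)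
      (by fun_prop)).mono fun f _ => ?_
    exact ⟨(toC (reC f), toC (imC f)), ⟨mem_closure_lipCompact (isSelfAdjoint_toC _),
      mem_closure_lipCompact (isSelfAdjoint_toC _)⟩, toC_reC_add_imC f⟩
  exact TopologicalSpace.isSeparable_univ_iff.1 h3

theorem isProperQuantum_classical [Nonempty X] : (classicalTriple X).IsProperQuantum where
  quantumLocallyCompact := isQuantumLocallyCompact_classical
  separable := separableSpace_zeroAtInfty
  leibniz := leibnizOn_classical
  lsc := lowerSemicontinuousOn_lipSeminorm
  locStar_dense _ ha := closure_mono lipCompact_image_subset_locStar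
    (mem_closure_lipCompact (isLipschitzPair_classical.isSelfAdjoint _ ha))
  locStar_inter_dense _ ha := closure_mono
    (fun _ h => And.intro (lipCompact_image_subset_locStar h) trivial) (mem_closure_lipCompact ha.2)
  spec_proper := spec_proper_classical

end Classical

theorem isPPQMS_classical (X : PointedProperSpace.{u}) : (classical X).IsPPQMS :=
  have : Nonempty X.carrier := ⟨X.pt⟩
  isProperQuantum_classical (X := X.carrier)

/-! ### Restriction along an isometric embedding -/

section Restriction

variable {X Z : Type u} [MetricSpace X] [MetricSpace Z] {i : X → Z}

/-- An envelope for truncating Tietze extensions so that they vanish at infinity. The supremum of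
tents weighted by `|f p|` is Lipschitz, and exceeds `ε/2` only within distance `1` of the compact
image of `{ε/2 ≤ ‖f‖}`. -/
theorem exists_dominating [ProperSpace Z] (hi : Isometry i) (f : C₀(X, ℝ)) :
    ∃ w : C₀(Z, ℝ), ∀ x, |f x| ≤ w (i x) := by
  rcases isEmpty_or_nonempty X with hX | hX
  · exact ⟨0, fun x => hX.elim x⟩
  set w : Z → ℝ := fun z => ⨆ p, |f p| * max 0 (1 - dist (i p) z) with hw
  have hle1 : ∀ p z, max 0 (1 - dist (i p) z) ≤ 1 := fun p z =>
    max_le zero_le_one (sub_le_self _ dist_nonneg)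
  have hbdd : ∀ z, BddAbove (range fun p => |f p| * max 0 (1 - dist (i p) z)) := fun z =>
    ⟨‖f‖, by
      rintro _ ⟨p, rfl⟩
      exact (mul_le_of_le_one_right (abs_nonneg _) (hle1 p z)).trans (norm_apply_le f p)⟩
  have hlip : LipschitzWith ‖f‖₊ w := by
    refine LipschitzWith.of_le_add_mul _ fun z z' => ciSup_le fun p => ?_
    have h1 := le_ciSup (hbdd z') p
    have h2 : max 0 (1 - dist (i p) z) ≤ max 0 (1 - dist (i p) z') + dist z z' := by
      refine max_le (add_nonneg (le_max_left _ _) dist_nonneg) ?_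
      have := le_max_right 0 (1 - dist (i p) z')
      have := dist_triangle (i p) z z'
      linarith
    have h3 := mul_le_mul_of_nonneg_left h2 (abs_nonneg (f p))
    have h4 := mul_le_mul_of_nonneg_right (norm_apply_le f p) (dist_nonneg (x := z) (y := z'))
    rw [Real.norm_eq_abs] at h4
    rw [coe_nnnorm]
    linarith
  have h0 : ∀ z, 0 ≤ w z := fun z => Real.iSup_nonneg fun p =>
    mul_nonneg (abs_nonneg _) (le_max_left _ _)
  refine ⟨⟨⟨w, hlip.continuous⟩, ?_⟩, fun x => ?_⟩
  · refine Metric.tendsto_nhds.2 fun ε hε => ?_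
    have hK : IsCompact (Metric.cthickening 1 (i '' {x | ε / 2 ≤ ‖f x‖})) :=
      ((isCompact_le_norm f (half_pos hε)).image hi.continuous).cthickening
    filter_upwards [hK.compl_mem_cocompact] with z hz
    rw [Real.dist_0_eq_abs, abs_of_nonneg (h0 z)]
    refine (ciSup_le fun p => ?_ : w z ≤ ε / 2).trans_lt (half_lt_self hε)
    by_cases hp : ε / 2 ≤ ‖f p‖
    · have h1 : 1 < dist (i p) z := by
        by_contra! h
        exact hz (Metric.mem_cthickening_of_dist_le z (i p) _ _ (mem_image_of_mem _ hp)
          (by rwa [dist_comm]))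
      rw [max_eq_left (by linarith), mul_zero]
      positivity
    · exact (mul_le_of_le_one_right (abs_nonneg _) (hle1 p z)).trans (not_le.1 hp).le
  · have := le_ciSup (hbdd (i x)) x
    simpa using! this

variable [ProperSpace X]

/-- Restriction of real functions along an isometric embedding. -/
def restrictReal (i : X → Z) (hi : Isometry i) (f : C₀(Z, ℝ)) : C₀(X, ℝ) :=
  f.comp (⟨⟨i, hi.continuous⟩, hi.isClosedEmbedding.tendsto_cocompact⟩ : CocompactMap X Z)

@[simp] theorem restrictReal_apply (hi : Isometry i) (f : C₀(Z, ℝ)) (x : X) :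
    restrictReal i hi f x = f (i x) := rfl

theorem restrictHom_toC (hi : Isometry i) (f : C₀(Z, ℝ)) :
    restrictHom i hi (toC f) = toC (restrictReal i hi f) := rfl

theorem lipSeminorm_restrictHom_le (hi : Isometry i) (f : C₀(Z, ℂ)) :
    lipSeminorm X (restrictHom i hi f) ≤ lipSeminorm Z f := by
  refine le_lipSeminorm_of fun l hl => ?_
  obtain ⟨h1, h2⟩ := (lipSeminorm_le_iff f l).1 hl.le
  refine ⟨(isSelfAdjoint_iff _).2 fun x => (isSelfAdjoint_iff f).1 h1 (i x), ?_⟩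
  simpa using! h2.comp hi.lipschitz

/-- A Tietze extension is clamped between `-w` and `w`, which changes nothing on the image of `i`.
-/
theorem restrictReal_surjective [ProperSpace Z] (hi : Isometry i) :
    Function.Surjective (restrictReal i hi) := by
  intro f
  obtain ⟨w, hw⟩ := exists_dominating hi f
  obtain ⟨g, hg⟩ := ContinuousMap.exists_extension' hi.isClosedEmbedding f.toContinuousMap
  have hb : ∀ z, |max (-w z) (min (w z) (g z))| ≤ |w z| := fun z => by
    rw [abs_le]
    rcases max_cases (-w z) (min (w z) (g z)) with h | h <;>
    rcases min_cases (w z) (g z) with h' | h' <;> rcases abs_cases (w z) with h'' | h'' <;>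
    constructor <;> linarith
  refine ⟨⟨⟨fun z => max (-w z) (min (w z) (g z)), by fun_prop⟩, ?_⟩, ?_⟩
  · exact squeeze_zero_norm hb (by simpa using w.zero_at_infty'.abs)
  · ext x
    have h1 : g (i x) = f x := congrFun hg x
    have h2 := abs_le.1 (hw x)
    change max (-w (i x)) (min (w (i x)) (g (i x))) = f x
    rw [h1, min_eq_right h2.2, max_eq_right h2.1]

theorem restrictHom_surjective [ProperSpace Z] (hi : Isometry i) :
    Function.Surjective (restrictHom i hi) := by
  intro f
  obtain ⟨g, hg⟩ := restrictReal_surjective hi (reC f)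
  obtain ⟨h, hh⟩ := restrictReal_surjective hi (imC f)
  refine ⟨toC g + Complex.I • toC h, ?_⟩
  rw [map_add, map_smul, restrictHom_toC, restrictHom_toC, hg, hh, toC_reC_add_imC]

theorem isApproximateUnit_map {A B : Type u} [NonUnitalCStarAlgebra A] [NonUnitalCStarAlgebra B]
    (π : A →⋆ₙₐ[ℂ] B) (hπ : Function.Surjective π) {l : Filter A} (hl : l.IsApproximateUnit) :
    (l.map π).IsApproximateUnit where
  tendsto_mul_left b := by
    obtain ⟨a, rfl⟩ := hπ b
    refine tendsto_map'_iff.2 (((map_continuous π).tendsto a).comp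
      (hl.tendsto_mul_left a) |>.congr fun u => map_mul π a u)
  tendsto_mul_right b := by
    obtain ⟨a, rfl⟩ := hπ b
    refine tendsto_map'_iff.2 (((map_continuous π).tendsto a).comp
      (hl.tendsto_mul_right a) |>.congr fun u => map_mul π u a)
  neBot := hl.neBot.map π

theorem isTopographicMorphism_restrictHom [ProperSpace Z] (hi : Isometry i) :
    IsTopographicMorphism (classicalTriple Z) (classicalTriple X) (restrictHom i hi) where
  surjective := restrictHom_surjective hi
  map_mem _ _ := trivial
  map_approxUnit := by
    obtain ⟨l, hl⟩ := exists_isApproximateUnit C₀(Z, ℂ)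
    exact ⟨l, hl, univ_mem, isApproximateUnit_map (restrictHom i hi) (restrictHom_surjective hi) hl⟩

theorem reEval_pullback (hi : Isometry i) (φ : WeakDual ℂ C₀(X, ℂ)) (m : C₀(Z, ℝ)) :
    reEval (pullback (restrictHom i hi) φ) m = reEval φ (restrictReal i hi m) := rfl

theorem isCarried_pullback (hi : Isometry i) {φ : WeakDual ℂ C₀(X, ℂ)} {K : Set X} {K' : Set Z}
    (hK : i '' K ⊆ K') (h : IsCarried φ K) : IsCarried (pullback (restrictHom i hi) φ) K' :=
  fun m hm => (reEval_pullback hi φ m).trans <| h _ ⟨fun x => hm.1 (i x), fun _ hx =>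
    hm.2 _ (hK (mem_image_of_mem i hx))⟩

theorem pullback_mem_stateSpace [ProperSpace Z] (hi : Isometry i) {φ : WeakDual ℂ C₀(X, ℂ)}
    (hφ : φ ∈ stateSpace C₀(X, ℂ)) {K : Set X} (hK : IsCompact K) (h : IsCarried φ K) :
    pullback (restrictHom i hi) φ ∈ stateSpace C₀(Z, ℂ) := by
  refine stateSpace_of_isCarried (hK.image hi.continuous) (fun a => hφ.1 (restrictHom i hi a))
    (fun a => ?_) (isCarried_pullback hi Subset.rfl h)
  exact (norm_state_apply_le hφ (restrictHom i hi a)).trans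
    ((norm_le_iff _ (norm_nonneg a)).2 fun x => norm_apply_le a (i x))

end Restriction

/-! ### Balls in classical spaces -/

section Balls

variable {X : Type u} [MetricSpace X] [ProperSpace X]

theorem mem_statesOn_image_iff {K : Set X} (hK : IsCompact K) {φ : WeakDual ℂ C₀(X, ℂ)} :
    φ ∈ (classicalTriple X).statesOn (evalChar '' K) ↔
      φ ∈ stateSpace C₀(X, ℂ) ∧ IsCarried φ K := by
  rw [mem_statesOn_iff (hK.image continuous_evalChar), preimage_image_eq _ evalChar_injective]

theorem mem_loc_image_iff {K : Set X} (hK : IsCompact K) {a : C₀(X, ℂ)} :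
    a ∈ (classicalTriple X).loc (evalChar '' K) ↔
      lipSeminorm X a < ∞ ∧ ∀ x ∉ K, a x = 0 := by
  rw [mem_loc_iff (hK.image continuous_evalChar)]
  simp only [evalChar_injective.mem_set_image]

theorem mem_statesBall_iff (X : PointedProperSpace.{u}) {r : ℝ} (hr : 0 ≤ r)
    {φ : WeakDual ℂ C₀(X.carrier, ℂ)} :
    φ ∈ (classical X).statesBall r ↔
      φ ∈ stateSpace C₀(X.carrier, ℂ) ∧ IsCarried φ (Metric.closedBall X.pt r) := by
  rw [← mem_statesOn_image_iff (isCompact_closedBall _ _), ← specBall_eq_image _ hr]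
  rfl

theorem mem_locBall_iff (X : PointedProperSpace.{u}) {r : ℝ} (hr : 0 ≤ r)
    {a : C₀(X.carrier, ℂ)} :
    a ∈ (classical X).locBall r ↔
      lipSeminorm X.carrier a < ∞ ∧ ∀ x ∉ Metric.closedBall X.pt r, a x = 0 := by
  rw [← mem_loc_image_iff (isCompact_closedBall _ _), ← specBall_eq_image _ hr]
  rfl

end Balls

/-! ### Approximation of states by convex combinations of evaluations -/

section Approximation

variable {Z : Type u} [MetricSpace Z]

theorem sum_zeroAtInfty_apply (t : Finset Z) (f : Z → C₀(Z, ℝ)) (z : Z) :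
    (∑ p ∈ t, f p) z = ∑ p ∈ t, f p z :=
  map_sum (⟨⟨fun f : C₀(Z, ℝ) => f z, rfl⟩, fun _ _ => rfl⟩ : C₀(Z, ℝ) →+ ℝ) f t

variable [ProperSpace Z]

/-- Tents at a finite net are divided by `max B c`, with `B` their sum and `c > 0` a lower bound for
`B` on `K`: the quotients add up to `1` on `K` and to at most `1` elsewhere. -/
theorem exists_partition {K : Set Z} (hK : IsCompact K) {s : ℝ} (hs : 0 < s) :
    ∃ (t : Finset Z) (h : Z → C₀(Z, ℝ)), (↑t ⊆ K) ∧ (∀ p z, 0 ≤ h p z) ∧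
      (∀ p z, h p z ≠ 0 → dist z p ≤ s) ∧ IsCutoff K (∑ p ∈ t, h p) := by
  obtain ⟨t', htK, htf, hcov⟩ := hK.finite_cover_balls hs
  lift t' to Finset Z using htf
  set B : C₀(Z, ℝ) := ∑ p ∈ t', tent s p with hB
  have hBpos : ∀ z ∈ K, 0 < B z := fun z hz => by
    obtain ⟨p, hp, hzp⟩ := mem_iUnion₂.1 (hcov hz)
    rw [hB, sum_zeroAtInfty_apply]
    refine Finset.sum_pos' (fun q _ => le_max_left _ _) ⟨p, hp, lt_max_of_lt_right ?_⟩
    exact sub_pos.2 hzp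
  obtain ⟨c, hc, hcB⟩ : ∃ c : ℝ, 0 < c ∧ ∀ x ∈ K, c ≤ B x := by
    rcases K.eq_empty_or_nonempty with rfl | hne
    · exact ⟨1, one_pos, fun x hx => hx.elim⟩
    · obtain ⟨x, hx, hmin⟩ := hK.exists_isMinOn hne (map_continuous B).continuousOn
      exact ⟨B x, hBpos x hx, fun y hy => hmin hy⟩
  have hpos : ∀ z, 0 < max (B z) c := fun z => lt_max_of_lt_right hc
  have hcont : ∀ p, Continuous fun z => tent s p z / max (B z) c := fun p =>
    (map_continuous _).div ((map_continuous B).max continuous_const) fun z => (hpos z).ne'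
  have hvan : ∀ p, ∀ z ∉ Metric.closedBall p s, tent s p z / max (B z) c = 0 := fun p z hz => by
    have : s < dist z p := by simpa using hz
    rw [tent_apply, max_eq_left (by linarith), zero_div]
  have hsum : ∀ z, (∑ p ∈ t', ofCompact _ (hcont p) (isCompact_closedBall p s) (hvan p)) z =
      B z / max (B z) c := fun z => by
    rw [sum_zeroAtInfty_apply]
    simp only [ofCompact_apply]
    rw [← Finset.sum_div, hB, sum_zeroAtInfty_apply]
  have hB0 : ∀ z, 0 ≤ B z := fun z => by
    rw [hB, sum_zeroAtInfty_apply]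
    exact Finset.sum_nonneg fun p _ => le_max_left _ _
  refine ⟨t', fun p => ofCompact _ (hcont p) (isCompact_closedBall p s) (hvan p), htK,
    fun p z => div_nonneg (le_max_left _ _) (hpos z).le, fun p z hz => ?_, fun z => ?_,
    fun z hz => ?_⟩
  · by_contra hzp
    exact hz (hvan p z hzp)
  · rw [hsum]
    exact ⟨div_nonneg (hB0 z) (hpos z).le, (div_le_one (hpos z)).2 (le_max_left _ _)⟩
  · rw [hsum, max_eq_left (hcB z hz), div_self (hBpos z hz).ne']

/-- Each piece of a partition of unity is concentrated at a point `q p` of `X` near its centre,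
giving `ψ = ∑ φ(g p) δ_{q p}`. A 1-Lipschitz function changes by at most `s` across a piece and `s`
more up to `i (q p)`. -/
theorem exists_state_close {X : Type u} [MetricSpace X] [ProperSpace X] [Nonempty X] {i : X → Z}
    (hi : Isometry i) {K : Set Z} (hK : IsCompact K) {K' : Set X} (hK' : IsCompact K') {s : ℝ}
    (hs : 0 < s) (hnear : ∀ z ∈ K, ∃ x ∈ K', dist z (i x) ≤ s) {φ : WeakDual ℂ C₀(Z, ℂ)}
    (hφ : φ ∈ stateSpace C₀(Z, ℂ)) (h : IsCarried φ K) :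
    ∃ ψ ∈ stateSpace C₀(X, ℂ), IsCarried ψ K' ∧
      (classicalTriple Z).mkDist φ (pullback (restrictHom i hi) ψ) ≤ ENNReal.ofReal (2 * s) := by
  obtain ⟨t, g, htK, hg0, hgs, hcut⟩ := exists_partition hK hs
  choose! q hqK' hq using hnear
  have hw0 : ∀ p, 0 ≤ reEval φ (g p) := fun p => reEval_nonneg hφ (hg0 p)
  have hw1 : ∑ p ∈ t, reEval φ (g p) = 1 := by rw [← map_sum]; exact h _ hcut
  let ψ : WeakDual ℂ C₀(X, ℂ) := ∑ p ∈ t, ((reEval φ (g p) : ℝ) : ℂ) • evalState (q p)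
  have hψ : ∀ f, ψ f = ∑ p ∈ t, ((reEval φ (g p) : ℝ) : ℂ) * f (q p) := fun f => by
    simp only [ψ]
    rw [← WeakDual.toStrongDual_apply, map_sum, _root_.sum_apply]
    rfl
  have hψr : ∀ f, reEval ψ f = ∑ p ∈ t, reEval φ (g p) * f (q p) := fun f => by
    change (ψ (toC f)).re = _
    rw [hψ, Complex.re_sum]
    exact Finset.sum_congr rfl fun p _ => by simp
  have hcar : IsCarried ψ K' := fun m hm => by
    rw [hψr, ← hw1]
    exact Finset.sum_congr rfl fun p hp => by rw [hm.2 _ (hqK' p (htK hp)), mul_one]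
  have hψs : ψ ∈ stateSpace C₀(X, ℂ) := by
    refine stateSpace_of_isCarried hK' (fun a => ?_) (fun a => ?_) hcar
    · rw [hψ]
      exact Finset.sum_nonneg fun p _ => mul_nonneg (by exact_mod_cast hw0 p)
        (star_mul_self_nonneg (a (q p)))
    · rw [hψ]
      refine (norm_sum_le _ _).trans ?_
      calc _ ≤ ∑ p ∈ t, reEval φ (g p) * ‖a‖ := Finset.sum_le_sum fun p _ => by
            rw [norm_mul, Complex.norm_real, Real.norm_of_nonneg (hw0 p)]
            exact mul_le_mul_of_nonneg_left (norm_apply_le a _) (hw0 p)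
        _ = ‖a‖ := by rw [← Finset.sum_mul, hw1, one_mul]
  refine ⟨ψ, hψs, hcar, mkDist_le_of hφ (pullback_mem_stateSpace hi hψs hK' hcar) fun a ha => ?_⟩
  have e : reEval φ a - reEval (pullback (restrictHom i hi) ψ) a =
      reEval φ (a - ∑ p ∈ t, a (i (q p)) • g p) := by
    rw [map_sub, map_sum, reEval_pullback, hψr]
    congr 1
    exact Finset.sum_congr rfl fun p _ => by
      rw [map_smul, smul_eq_mul, restrictReal_apply, mul_comm]
  have hb : ∀ z ∈ K, |(a - ∑ p ∈ t, a (i (q p)) • g p) z| ≤ 2 * s := fun z hz => by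
    have h1 : ∑ p ∈ t, g p z = 1 := by rw [← sum_zeroAtInfty_apply]; exact hcut.2 z hz
    have e2 : (a - ∑ p ∈ t, a (i (q p)) • g p) z = ∑ p ∈ t, (a z - a (i (q p))) * g p z := by
      rw [ZeroAtInftyContinuousMap.sub_apply, sum_zeroAtInfty_apply]
      simp only [ZeroAtInftyContinuousMap.smul_apply, smul_eq_mul, sub_mul]
      rw [Finset.sum_sub_distrib, ← Finset.mul_sum, h1, mul_one]
    rw [e2]
    refine (Finset.abs_sum_le_sum_abs _ _).trans ?_
    calc _ ≤ ∑ p ∈ t, 2 * s * g p z := Finset.sum_le_sum fun p hp => by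
          rw [abs_mul, abs_of_nonneg (hg0 p z)]
          by_cases h0 : g p z = 0
          · rw [h0, mul_zero, mul_zero]
          · refine mul_le_mul_of_nonneg_right ?_ (hg0 p z)
            have h2 := ha.dist_le_mul z (i (q p))
            rw [Real.dist_eq, NNReal.coe_one, one_mul] at h2
            have h3 := dist_triangle z p (i (q p))
            have h4 := hgs p z h0
            have h5 := hq p (htK hp)
            linarith
      _ = 2 * s := by rw [← Finset.mul_sum, h1, mul_one]
  rw [e, abs_le]
  exact ⟨h.ge hφ hK fun z hz => (abs_le.1 (hb z hz)).1,
    h.le hφ hK fun z hz => (abs_le.1 (hb z hz)).2⟩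

end Approximation

/-! ### Tunnels between classical spaces -/

section Tunnel

/-- Embeddings of two pointed spaces into a metric space which they cover, such that every point
of the second space in a large ball is close to a point of the first one, and such that the first
space has points outside of a ball at most as far from the points of that ball as the points of the
second space outside of a slightly larger ball. -/
structure IsHalfGluing (X Y : PointedProperSpace.{u}) {Z : Type u} [MetricSpace Z]
    (i : X.carrier → Z) (j : Y.carrier → Z) (R s : ℝ) : Prop where
  cover : ∀ z, z ∈ range i ∨ z ∈ range j
  base : dist (i X.pt) (j Y.pt) ≤ s
  near : ∀ q, dist q Y.pt ≤ R + s → ∃ p, dist (j q) (i p) ≤ s ∧ dist p X.pt ≤ dist q Y.pt + s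
  escape : ∀ t ≤ R, ∀ p q, dist p X.pt ≤ t → t + s < dist q Y.pt →
    ∃ p', t < dist p' X.pt ∧ dist p p' ≤ dist (i p) (j q)

variable {X Y : PointedProperSpace.{u}} {Z : Type u} {i : X.carrier → Z} {j : Y.carrier → Z}
  {R s : ℝ}

/-- The union of the two balls of radius `t` about the base points. -/
def ballUnion (X Y : PointedProperSpace.{u}) (i : X.carrier → Z) (j : Y.carrier → Z) (t : ℝ) :
    Set Z :=
  i '' Metric.closedBall X.pt t ∪ j '' Metric.closedBall Y.pt t

theorem ballUnion_mono {t t' : ℝ} (h : t ≤ t') : ballUnion X Y i j t ⊆ ballUnion X Y i j t' :=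
  union_subset_union (image_mono (Metric.closedBall_subset_closedBall h))
    (image_mono (Metric.closedBall_subset_closedBall h))

theorem ballUnion_comm (t : ℝ) : ballUnion X Y i j t = ballUnion Y X j i t := union_comm _ _

variable [MetricSpace Z]

theorem isCompact_ballUnion (hi : Isometry i) (hj : Isometry j) (t : ℝ) :
    IsCompact (ballUnion X Y i j t) :=
  ((isCompact_closedBall _ _).image hi.continuous).union
    ((isCompact_closedBall _ _).image hj.continuous)

/-- The zero extension to far points of `Y` stays `l`-Lipschitz because `escape` supplies a zero
`p'` of `g` no farther from `p` than the far point; McShane's extension then keeps the constant. -/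
theorem exists_lipschitz_extension (hi : Isometry i) (h : IsHalfGluing X Y i j R s) {t : ℝ}
    (htR : t ≤ R) {l : ℝ≥0} {g : X.carrier → ℝ} (hg : LipschitzWith l g)
    (hs : 0 ≤ s) (hgt : ∀ p, t < dist p X.pt → g p = 0) :
    ∃ d : Z → ℝ, LipschitzWith l d ∧ (∀ p, d (i p) = g p) ∧
      ∀ z ∉ ballUnion X Y i j (t + s), d z = 0 := by
  set F : Z → ℝ := Function.extend i g (fun _ => 0)
  have hFi : ∀ p, F (i p) = g p := fun p => hi.injective.extend_apply g _ p
  have hF0 : ∀ z, z ∉ range i → F z = 0 := fun z hz => Function.extend_apply' g _ z hz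
  -- Points of `Y` at distance at most `t + s` are left out: there the extension is free, and they
  -- already lie in the compact set.
  set S : Set Z := range i ∪ j '' {q | t + s < dist q Y.pt}
  have key : ∀ p q, t + s < dist q Y.pt → |g p| ≤ l * dist (i p) (j q) := fun p q hq => by
    rcases lt_or_ge t (dist p X.pt) with hp | hp
    · rw [hgt p hp, abs_zero]; positivity
    · obtain ⟨p', hp', hpp'⟩ := h.escape t htR p q hp hq
      have h1 := hg.dist_le_mul p p'
      rw [hgt p' hp', Real.dist_0_eq_abs] at h1
      exact h1.trans (mul_le_mul_of_nonneg_left hpp' l.coe_nonneg)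
  have hFS : LipschitzOnWith l F S := by
    refine LipschitzOnWith.of_dist_le_mul fun z hz z' hz' => ?_
    by_cases hzi : z ∈ range i <;> by_cases hzi' : z' ∈ range i
    · obtain ⟨p, rfl⟩ := hzi
      obtain ⟨p', rfl⟩ := hzi'
      rw [hFi, hFi, hi.dist_eq]
      exact hg.dist_le_mul p p'
    · obtain ⟨p, rfl⟩ := hzi
      obtain ⟨q, hq, rfl⟩ := hz'.resolve_left hzi'
      rw [hFi, hF0 _ hzi', Real.dist_0_eq_abs]
      exact key p q hq
    · obtain ⟨p, rfl⟩ := hzi'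
      obtain ⟨q, hq, rfl⟩ := hz.resolve_left hzi
      rw [hFi, hF0 _ hzi, dist_comm, Real.dist_0_eq_abs, dist_comm]
      exact key p q hq
    · rw [hF0 _ hzi, hF0 _ hzi', dist_self]; positivity
  obtain ⟨d, hd, hdF⟩ := hFS.extend_real
  refine ⟨d, hd, fun p => by rw [← hdF (Or.inl (mem_range_self p)), hFi], fun z hz => ?_⟩
  by_cases hzi : z ∈ range i
  · obtain ⟨p, rfl⟩ := hzi
    rw [← hdF (Or.inl (mem_range_self p)), hFi]
    refine hgt p (lt_of_not_ge fun hp => hz (Or.inl ⟨p, ?_, rfl⟩))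
    exact Metric.mem_closedBall.2 (by linarith)
  · obtain ⟨q, rfl⟩ := (h.cover z).resolve_left hzi
    have hq : t + s < dist q Y.pt := lt_of_not_ge fun hq => hz (Or.inr ⟨q, hq, rfl⟩)
    rw [← hdF (Or.inr ⟨q, hq, rfl⟩), hF0 _ hzi]

variable [ProperSpace Z]

/-- Moving states costs `2 * s`, which fixes the extent. Radii grow only to `t + 2 * s`, well inside
the allowed `t + 4 * (2 * s)`. -/
theorem isLeftAdmissible_classical (hi : Isometry i) (hj : Isometry j)
    (h : IsHalfGluing X Y i j R s) {t : ℝ} (ht : 0 < t) (htR : t ≤ R) (hs : 0 < s) :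
    (classicalPassage X Y Z i hi j hj).IsLeftAdmissible t (2 * s)
      (evalChar '' ballUnion X Y i j (t + s)) := by
  have hK := isCompact_ballUnion (X := X) (Y := Y) hi hj (t + s)
  have hlift : ∀ a ∈ (classical X).locBall t, ((classicalPassage X Y Z i hi j hj).targetSet a
      ((classical X).L a) t (2 * s) (evalChar '' ballUnion X Y i j (t + s))).Nonempty := by
    intro a ha
    change C₀(X.carrier, ℂ) at a
    obtain ⟨ha1, ha2⟩ := (mem_locBall_iff X ht.le).1 ha
    obtain ⟨l, hl, hsa, hlip⟩ := lipSeminorm_lt_top ha1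
    have hlip' : LipschitzWith l (reC a) := by
      rwa [← lipschitzWith_toC_iff, toC_reC hsa]
    obtain ⟨d, hd, hdi, hd0⟩ := exists_lipschitz_extension hi h htR hlip' hs.le fun p hp => by
      rw [reC_apply, ha2 p (by simpa using hp), Complex.zero_re]
    set D : C₀(Z, ℝ) := ofCompact d hd.continuous hK hd0
    have hDl : lipSeminorm Z (toC D) ≤ l := (lipSeminorm_toC_le_iff D l).2 hd
    have hDa : restrictHom i hi (toC D) = a := by
      rw [← toC_reC hsa]
      ext p
      exact congrArg Complex.ofReal (hdi p)
    refine ⟨restrictHom j hj (toC D), toC D, ⟨?_, hDa, ?_, hDl.trans hl.ge⟩, rfl⟩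
    · refine (mem_loc_image_iff hK).2 ⟨hDl.trans_lt ENNReal.coe_lt_top, fun z hz => ?_⟩
      exact (congrArg Complex.ofReal (hd0 z hz)).trans Complex.ofReal_zero
    · refine (mem_locBall_iff Y (by positivity)).2
        ⟨(lipSeminorm_restrictHom_le hj _).trans_lt (hDl.trans_lt ENNReal.coe_lt_top),
        fun q hq => ?_⟩
      refine (congrArg Complex.ofReal (hd0 (j q) ?_)).trans Complex.ofReal_zero
      rw [Metric.mem_closedBall, not_le] at hq
      -- The two images may overlap, so `j q` can be a point of the ball of `X`; then `base` bounds
      -- its distance to `Y.pt` by `t + 2 * s`.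
      rintro (⟨p, hp, hpq⟩ | ⟨q', hq', hqq⟩)
      · have h1 := dist_triangle (j q) (i X.pt) (j Y.pt)
        rw [← hpq, hi.dist_eq, hpq, hj.dist_eq] at h1
        have h2 := h.base
        rw [Metric.mem_closedBall] at hp
        linarith
      · rw [hj.injective hqq, Metric.mem_closedBall] at hq'
        linarith
  constructor
  · intro φ hφ
    obtain ⟨h1, h2⟩ := (mem_statesBall_iff X ht.le).1 hφ
    refine (mem_statesOn_image_iff hK).2
      ⟨pullback_mem_stateSpace hi h1 (isCompact_closedBall _ _) h2,
        isCarried_pullback hi ?_ h2⟩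
    exact subset_union_of_subset_left
      (image_mono (Metric.closedBall_subset_closedBall (by linarith))) _
  · intro φ hφ
    obtain ⟨h1, h2⟩ := (mem_statesOn_image_iff hK).1 hφ
    have : Nonempty X.carrier := ⟨X.pt⟩
    have hnear : ∀ z ∈ ballUnion X Y i j (t + s),
        ∃ x ∈ Metric.closedBall X.pt (t + 4 * (2 * s)), dist z (i x) ≤ s := by
      rintro z (⟨p, hp, rfl⟩ | ⟨q, hq, rfl⟩)
      · rw [Metric.mem_closedBall] at hp
        exact ⟨p, Metric.mem_closedBall.2 (by linarith), by rw [dist_self]; exact hs.le⟩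
      · rw [Metric.mem_closedBall] at hq
        obtain ⟨p, hp1, hp2⟩ := h.near q (by linarith)
        exact ⟨p, Metric.mem_closedBall.2 (by linarith), hp1⟩
    obtain ⟨ψ, hψ, hc, hle⟩ := exists_state_close hi hK
      (isCompact_closedBall X.pt (t + 4 * (2 * s))) hs hnear h1 h2
    exact ⟨ψ, (mem_statesBall_iff X (by positivity)).2 ⟨hψ, hc⟩, hle⟩
  · exact hlift
  · intro a ha _
    obtain ⟨b, hb⟩ := hlift a ha
    exact ⟨b, hb, trivial⟩
  · exact fun d _ => lipSeminorm_restrictHom_le hj d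

theorem isPassage_classical (hi : Isometry i) (hj : Isometry j) :
    (classicalPassage X Y Z i hi j hj).IsPassage where
  dom_ppqms := isPPQMS_classical X
  cod_ppqms := isPPQMS_classical Y
  quantumLocallyCompact :=
    have : Nonempty Z := ⟨i X.pt⟩
    isQuantumLocallyCompact_classical (X := Z)
  lsc := lowerSemicontinuousOn_lipSeminorm
  topographic_left := isTopographicMorphism_restrictHom hi
  topographic_right := isTopographicMorphism_restrictHom hj

theorem mem_adm_classical (hi : Isometry i) (hj : Isometry j) (h : IsHalfGluing X Y i j R s)
    (h' : IsHalfGluing Y X j i R s) (hs : 0 < s) :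
    2 * s ∈ (classicalPassage X Y Z i hi j hj).adm R := by
  refine ⟨by positivity, fun t => evalChar '' ballUnion X Y i j (t + s),
    fun t _ t' _ htt' => image_mono (ballUnion_mono (by linarith)), fun t ht => ?_⟩
  have hK := isCompact_ballUnion (X := X) (Y := Y) hi hj (t + s)
  exact {
    pos := by positivity
    isCompact := hK.image continuous_evalChar
    left := isLeftAdmissible_classical hi hj h ht.1 ht.2 hs
    right := by
      dsimp only
      rw [ballUnion_comm]
      exact isLeftAdmissible_classical hj hi h' ht.1 ht.2 hs
    base := by
      refine le_trans (le_of_eq (mkTop_evalChar (i X.pt) (j Y.pt))) ?_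
      rw [edist_dist]
      exact ENNReal.ofReal_le_ofReal (h.base.trans (by linarith))
    leibniz := leibnizOn_classical }

theorem localPropinquity_classical_le {T : Set Passage.{u}}
    (hT : ∀ (X Y : PointedProperSpace.{u}) (Z : Type u) [MetricSpace Z] [ProperSpace Z]
      (i : X.carrier → Z) (hi : Isometry i) (j : Y.carrier → Z) (hj : Isometry j),
      (∃ r : ℝ, (classicalPassage X Y Z i hi j hj).IsTunnel r) →
        classicalPassage X Y Z i hi j hj ∈ T)
    (hi : Isometry i) (hj : Isometry j) (h : IsHalfGluing X Y i j R s)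
    (h' : IsHalfGluing Y X j i R s) (hR : 0 < R) (hs : 0 < s) :
    localPropinquity T R (classical X) (classical Y) ≤ ENNReal.ofReal (2 * s) := by
  have hadm := mem_adm_classical hi hj h h' hs
  have ht : (classicalPassage X Y Z i hi j hj).IsTunnel R :=
    ⟨isPassage_classical hi hj, hR, _, hadm⟩
  exact iInf₂_le_of_le _ ⟨hT X Y Z i hi j hj ⟨R, ht⟩, rfl, rfl, ht⟩ (iInf₂_le _ hadm)

end Tunnel

/-! ### Gromov-Hausdorff convergence -/

section GromovHausdorff

theorem isCompact_image_preimage_closedBall {W Z : Type*} [MetricSpace W] [ProperSpace W]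
    [MetricSpace Z] {k : W → Z} (hk : Isometry k) (z : Z) (r : ℝ) :
    IsCompact (k '' (k ⁻¹' Metric.closedBall z r)) :=
  (Metric.isCompact_of_isClosed_isBounded (Metric.isClosed_closedBall.preimage hk.continuous)
    (hk.antilipschitz.isBounded_preimage Metric.isBounded_closedBall)).image hk.continuous

/-- The ambient space of a Gromov-Hausdorff estimate need not be proper, whereas a space covered by
two proper pieces is. -/
theorem properSpace_of_cover {X Y Z : Type*} [MetricSpace X] [ProperSpace X] [MetricSpace Y]
    [ProperSpace Y] [MetricSpace Z] {i : X → Z} {j : Y → Z} (hi : Isometry i)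
    (hj : Isometry j) (h : ∀ z, z ∈ range i ∨ z ∈ range j) : ProperSpace Z := by
  refine ⟨fun z r => ?_⟩
  have e : Metric.closedBall z r =
      i '' (i ⁻¹' Metric.closedBall z r) ∪ j '' (j ⁻¹' Metric.closedBall z r) := by
    rw [image_preimage_eq_inter_range, image_preimage_eq_inter_range, ← inter_union_distrib_left]
    exact (inter_eq_left.2 fun z _ => h z).symm
  rw [e]
  exact (isCompact_image_preimage_closedBall hi z r).union
    (isCompact_image_preimage_closedBall hj z r)

/-- Two subspaces of a metric space can be moved apart by a distance `η`. -/
theorem exists_separated_embedding {X Y Z : Type u} [MetricSpace X] [MetricSpace Y] [MetricSpace Z]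
    {i : X → Z} {j : Y → Z} (hi : Isometry i) (hj : Isometry j) {η : ℝ} (hη : 0 ≤ η) :
    ∃ (Z' : Type u) (_ : MetricSpace Z') (i' : X → Z') (j' : Y → Z'), Isometry i' ∧ Isometry j' ∧
      (∀ z, z ∈ range i' ∨ z ∈ range j') ∧ ∀ p q, dist (i' p) (j' q) = dist (i p) (j q) + η := by
  -- In the `ℓ¹` product with the line, placing the spaces at heights `0` and `η` adds exactly `η`
  -- to each cross distance and nothing within a space.
  let i₁ : X → WithLp 1 (Z × ℝ) := fun p => WithLp.toLp 1 (i p, 0)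
  let j₁ : Y → WithLp 1 (Z × ℝ) := fun q => WithLp.toLp 1 (j q, η)
  have hd : ∀ a b : WithLp 1 (Z × ℝ), dist a b = dist a.fst b.fst + dist a.snd b.snd := by
    intro a b
    rw [WithLp.prod_dist_eq_add (by simp)]
    simp
  refine ⟨(range i₁ ∪ range j₁ : Set (WithLp 1 (Z × ℝ))), inferInstance,
    fun p => ⟨i₁ p, Or.inl (mem_range_self p)⟩, fun q => ⟨j₁ q, Or.inr (mem_range_self q)⟩,
    Isometry.of_dist_eq fun p p' => ?_, Isometry.of_dist_eq fun q q' => ?_, ?_, fun p q => ?_⟩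
  · rw [Subtype.dist_eq, hd]
    simp [i₁, hi.dist_eq]
  · rw [Subtype.dist_eq, hd]
    simp [j₁, hj.dist_eq]
  · rintro ⟨z, ⟨p, rfl⟩ | ⟨q, rfl⟩⟩
    · exact Or.inl ⟨p, rfl⟩
    · exact Or.inr ⟨q, rfl⟩
  · rw [Subtype.dist_eq, hd]
    simp [i₁, j₁, Real.dist_eq, abs_of_nonneg hη]

variable {X Y : PointedProperSpace.{u}}

theorem exists_embedding_of_DeltaR_lt {r η : ℝ} (h : DeltaR r X Y < ENNReal.ofReal η) :
    ∃ (Z : Type u) (_ : MetricSpace Z) (i : X.carrier → Z) (j : Y.carrier → Z), Isometry i ∧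
      Isometry j ∧ dist (i X.pt) (j Y.pt) ≤ η ∧
      (∀ p, dist p X.pt ≤ r → ∃ q, dist (i p) (j q) ≤ η) ∧
      ∀ q, dist q Y.pt ≤ r → ∃ p, dist (j q) (i p) ≤ η := by
  simp only [DeltaR, deltaR, iInf_lt_iff] at h
  obtain ⟨Z, hZ, i, j, ⟨hi, hj⟩, ε, ⟨hε, h1, h2, h3⟩, hlt⟩ := h
  have hle : ε ≤ η := ((ENNReal.ofReal_lt_ofReal_iff_of_nonneg hε.le).1 hlt).le
  refine ⟨Z, hZ, i, j, hi, hj, h1.trans hle, fun p hp => ?_, fun q hq => ?_⟩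
  · obtain ⟨_, ⟨q, rfl⟩, hq⟩ := h2 (i p) ⟨mem_range_self p, by
      rwa [Metric.mem_closedBall, hi.dist_eq]⟩
    exact ⟨q, hq.trans hle⟩
  · obtain ⟨_, ⟨p, rfl⟩, hp⟩ := h3 (j q) ⟨mem_range_self q, by
      rwa [Metric.mem_closedBall, hj.dist_eq]⟩
    exact ⟨p, hp.trans hle⟩

/-- For `escape` with `q` inside radius `r`, a neighbour `p'` of `q` works: the error `η` in `dist p
p'` is absorbed by the separation. For `q` beyond `r`, the fixed `p₀` works, since `dist p p₀ ≤ t +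
dist p₀ X.pt` while `q` is at least `r - t` away from `p` after separation. -/
theorem isHalfGluing_of_separated {Z Z' : Type u} [MetricSpace Z] [MetricSpace Z']
    {i : X.carrier → Z} {j : Y.carrier → Z} {i' : X.carrier → Z'} {j' : Y.carrier → Z'}
    (hi : Isometry i) (hj : Isometry j) {η r R : ℝ}
    (hcov : ∀ z, z ∈ range i' ∨ z ∈ range j')
    (hd : ∀ p q, dist (i' p) (j' q) = dist (i p) (j q) + η)
    (hbase : dist (i X.pt) (j Y.pt) ≤ η)
    (hnear : ∀ q, dist q Y.pt ≤ r → ∃ p, dist (j q) (i p) ≤ η) (hr : R + 2 * η ≤ r)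
    (hfar : (∀ q, dist q Y.pt ≤ r) ∨ ∃ p₀, R < dist p₀ X.pt ∧ 2 * R + dist p₀ X.pt ≤ r) :
    IsHalfGluing X Y i' j' R (2 * η) where
  cover := hcov
  base := by rw [hd]; linarith
  near q hq := by
    obtain ⟨p, hp⟩ := hnear q (hq.trans hr)
    refine ⟨p, by rw [dist_comm, hd, dist_comm]; linarith, ?_⟩
    have h1 := dist_triangle4 (i p) (j q) (j Y.pt) (i X.pt)
    rw [hi.dist_eq, hj.dist_eq, dist_comm (i p), dist_comm (j Y.pt)] at h1
    linarith
  escape t ht p q hp hq := by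
    rcases le_or_gt (dist q Y.pt) r with hqr | hqr
    · obtain ⟨p', hp'⟩ := hnear q hqr
      refine ⟨p', ?_, ?_⟩
      · have h1 := dist_triangle4 (j q) (i p') (i X.pt) (j Y.pt)
        rw [hi.dist_eq, hj.dist_eq] at h1
        linarith
      · have h1 := dist_triangle (i p) (j q) (i p')
        rw [hi.dist_eq] at h1
        rw [hd]
        linarith
    · rcases hfar with hfar | ⟨p₀, h1, h2⟩
      · exact absurd (hfar q) (not_le.2 hqr)
      · refine ⟨p₀, ht.trans_lt h1, ?_⟩
        have h3 := dist_triangle4 (j q) (i p) (i X.pt) (j Y.pt)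
        rw [hi.dist_eq, hj.dist_eq, dist_comm (j q)] at h3
        have h4 := dist_triangle_right p p₀ X.pt
        rw [hd]
        linarith

theorem localPropinquity_le_of_DeltaR_lt {T : Set Passage.{u}}
    (hT : ∀ (X Y : PointedProperSpace.{u}) (Z : Type u) [MetricSpace Z] [ProperSpace Z]
      (i : X.carrier → Z) (hi : Isometry i) (j : Y.carrier → Z) (hj : Isometry j),
      (∃ r : ℝ, (classicalPassage X Y Z i hi j hj).IsTunnel r) →
        classicalPassage X Y Z i hi j hj ∈ T)
    {η r R : ℝ} (hη : 0 < η) (hR : 0 < R) (hr : R + 2 * η ≤ r)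
    (h : DeltaR r X Y < ENNReal.ofReal η)
    (hfar : ((∀ p : X.carrier, dist p X.pt ≤ r) ∧ ∀ q : Y.carrier, dist q Y.pt ≤ r) ∨
      ∃ q₀, R + 2 * η < dist q₀ Y.pt ∧ 2 * R + dist q₀ Y.pt + 2 * η ≤ r) :
    localPropinquity T R (classical X) (classical Y) ≤ ENNReal.ofReal (4 * η) := by
  obtain ⟨Z, hZ, i, j, hi, hj, hbase, hXY, hYX⟩ := exists_embedding_of_DeltaR_lt h
  obtain ⟨Z', hZ', i', j', hi', hj', hcov, hd⟩ := exists_separated_embedding hi hj hη.le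
  have := properSpace_of_cover hi' hj' hcov
  have h1 : IsHalfGluing X Y i' j' R (2 * η) := by
    refine isHalfGluing_of_separated hi hj hcov hd hbase hYX hr ?_
    refine hfar.imp (fun hf => hf.2) ?_
    rintro ⟨q₀, h1, h2⟩
    -- The far point of `Y` is transported to `X`; its distance to the base point changes by at most
    -- `2 * η`, the margin built into `hfar`.
    obtain ⟨p₀, hp₀⟩ := hYX q₀ (by linarith)
    have h3 := dist_triangle4 (i p₀) (j q₀) (j Y.pt) (i X.pt)
    have h4 := dist_triangle4 (j q₀) (i p₀) (i X.pt) (j Y.pt)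
    rw [hi.dist_eq, hj.dist_eq, dist_comm (i p₀), dist_comm (j Y.pt)] at h3
    rw [hi.dist_eq, hj.dist_eq] at h4
    exact ⟨p₀, by linarith, by linarith⟩
  have h2 : IsHalfGluing Y X j' i' R (2 * η) := by
    refine isHalfGluing_of_separated hj hi (fun z => (hcov z).symm)
      (fun q p => by rw [dist_comm, hd, dist_comm]) (by rwa [dist_comm]) hXY hr ?_
    refine hfar.imp (fun hf => hf.1) ?_
    rintro ⟨q₀, h1, h2⟩
    exact ⟨q₀, by linarith, by linarith⟩
  have h3 := localPropinquity_classical_le hT hi' hj' h1 h2 hR (show 0 < 2 * η by positivity)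
  rwa [← mul_assoc, show (2 : ℝ) * 2 = 4 by norm_num] at h3

theorem propinquity_le {T : Set Passage.{u}} {A B : PointedTriple.{u}} {ε : ℝ} (hε : 0 < ε)
    (h : localPropinquity T ε⁻¹ A B < ENNReal.ofReal ε) : propinquity T A B ≤ ε :=
  ENNReal.toReal_le_of_le_ofReal hε.le ((min_le_left _ _).trans (iInf₂_le ε ⟨hε, h⟩))

theorem tendsto_propinquity_classical {T : Set Passage.{u}}
    (hT : ∀ (X Y : PointedProperSpace.{u}) (Z : Type u) [MetricSpace Z] [ProperSpace Z]
      (i : X.carrier → Z) (hi : Isometry i) (j : Y.carrier → Z) (hj : Isometry j),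
      (∃ r : ℝ, (classicalPassage X Y Z i hi j hj).IsTunnel r) →
        classicalPassage X Y Z i hi j hj ∈ T)
    {X : ℕ → PointedProperSpace.{u}} (hX : GHTendsto X Y)
    (hY : ¬ CompactSpace Y.carrier ∨
      ∃ R : ℝ, ∀ᶠ n in atTop, ∀ p q : (X n).carrier, dist p q ≤ R) :
    Tendsto (fun n => propinquity T (classical (X n)) (classical Y)) atTop (𝓝 0) := by
  refine Metric.tendsto_nhds.2 fun ε₀ hε₀ => ?_
  set ε := ε₀ / 2 with hε
  have hεpos : 0 < ε := by positivity
  set R := ε⁻¹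
  have hR : 0 < R := inv_pos.2 hεpos
  -- The local propinquity will be at most `4 * η = ε / 2`, strictly below `ε`.
  set η := ε / 8
  have hη : 0 < η := by positivity
  -- One radius must serve all large `n`, since convergence is applied at that `r`. For compact `Y`
  -- it exceeds every distance to a base point; otherwise it comes from a single far point `q₀` of
  -- `Y`.
  obtain ⟨r, hr, hfar⟩ : ∃ r, R + 2 * η ≤ r ∧ ∀ᶠ n in atTop,
      ((∀ p : (X n).carrier, dist p (X n).pt ≤ r) ∧ ∀ q : Y.carrier, dist q Y.pt ≤ r) ∨
        ∃ q₀, R + 2 * η < dist q₀ Y.pt ∧ 2 * R + dist q₀ Y.pt + 2 * η ≤ r := by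
    by_cases hc : CompactSpace Y.carrier
    · obtain ⟨B, hB⟩ := hY.resolve_left (not_not.2 hc)
      obtain ⟨B', hB'⟩ := (isCompact_univ (X := Y.carrier)).isBounded.subset_closedBall Y.pt
      refine ⟨max (R + 2 * η) (max B B'), le_max_left _ _, hB.mono fun n hn => Or.inl
        ⟨fun p => (hn p _).trans ((le_max_left _ _).trans (le_max_right _ _)), fun q => ?_⟩⟩
      exact (Metric.mem_closedBall.1 (hB' (mem_univ q))).trans
        ((le_max_right _ _).trans (le_max_right _ _))
    · obtain ⟨q₀, hq₀⟩ : ∃ q₀, R + 2 * η < dist q₀ Y.pt := by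
        by_contra! h
        exact hc ⟨(isCompact_closedBall Y.pt (R + 2 * η)).of_isClosed_subset isClosed_univ
          fun q _ => Metric.mem_closedBall.2 (h q)⟩
      exact ⟨2 * R + dist q₀ Y.pt + 2 * η, by linarith [dist_nonneg (x := q₀) (y := Y.pt)],
        Eventually.of_forall fun n => Or.inr ⟨q₀, hq₀, le_rfl⟩⟩
  have hΔ : ∀ᶠ n in atTop, DeltaR r (X n) Y < ENNReal.ofReal η :=
    (hX r (by linarith)).eventually_lt_const (ENNReal.ofReal_pos.2 hη)
  filter_upwards [hfar, hΔ] with n hn1 hn2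
  have h1 := localPropinquity_le_of_DeltaR_lt hT hη hR hr hn2 hn1
  have h2 : localPropinquity T ε⁻¹ (classical (X n)) (classical Y) < ENNReal.ofReal ε :=
    h1.trans_lt ((ENNReal.ofReal_lt_ofReal_iff hεpos).2 (by simp only [η]; linarith))
  have h3 := propinquity_le hεpos h2
  have h4 : 0 ≤ propinquity T (classical (X n)) (classical Y) := ENNReal.toReal_nonneg
  rw [Real.dist_0_eq_abs, abs_of_nonneg h4]
  linarith

end GromovHausdorff

end

end TopoProp

theorem mainTheorem5 (C : Set PointedTriple.{u}) (T : Set Passage.{u})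
    (hC : ∀ A ∈ C, A.IsPPQMS)
    (hC_classical : ∀ X : PointedProperSpace.{u}, (classical X).IsPPQMS → classical X ∈ C)
    (hT : WeaklyAppropriate C T)
    (hT_classical : ∀ (X Y : PointedProperSpace.{u}) (Z : Type u) [MetricSpace Z] [ProperSpace Z]
      (i : X.carrier → Z) (hi : Isometry i) (j : Y.carrier → Z) (hj : Isometry j),
      (∃ r : ℝ, (classicalPassage X Y Z i hi j hj).IsTunnel r) →
        classicalPassage X Y Z i hi j hj ∈ T) :
    (∀ X : PointedProperSpace.{u}, (classical X).IsPPQMS) ∧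
    (∀ (X : ℕ → PointedProperSpace.{u}) (Y : PointedProperSpace.{u}),
      GHTendsto X Y →
      (¬ CompactSpace Y.carrier ∨
        ∃ R : ℝ, ∀ᶠ n in atTop, ∀ p q : (X n).carrier, dist p q ≤ R) →
      Tendsto (fun n => propinquity T (classical (X n)) (classical Y)) atTop (𝓝 0)) ∧
    (∀ (S : Set PointedProperSpace.{u}) (X : ℕ → PointedProperSpace.{u})
      (Y : PointedProperSpace.{u}),
      (∀ n, X n ∈ S) → GHTendsto X Y → ¬ CompactSpace Y.carrier →
      classical Y ∈ hyperClosure C T (classical '' S)) := by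
  have hP : ∀ X : PointedProperSpace.{u}, (classical X).IsPPQMS := isPPQMS_classical
  refine ⟨hP, fun X Y hXY hY => tendsto_propinquity_classical hT_classical hXY hY,
    fun S X Y hS hXY hY => ⟨hC_classical Y (hP Y), fun n => classical (X n),
      fun n => mem_image_of_mem _ (hS n), ?_⟩⟩
  exact tendsto_propinquity_classical hT_classical hXY (Or.inl hY)
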